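/- Let $Q$ be a generalized quantifier of type $\langle q\rangle$, i.e. a class of structures $(M,A)$ with $M\neq\emptyset$ and $A\subseteq M^q$; put $Q_M=\{A\subseteq M^q : (M,A)\in Q\}$. Assume that $Q$ is monotone increasing (if $A\subseteq B\subseteq M^q$ and $A\in Q_M$, then $B\in Q_M$) and non-trivial ($\emptyset\notin Q_M$ and $M^q\in Q_M$ for every non-empty $M$). The formulas of $\mathrm{ESO}(Q)$ are built from atomic and negated atomic formulas by $\wedge$, $\vee$, first-order $\exists x$ and $\forall x$, $Q\bar x$, and second-order existential quantification over relations and over functions; here $\mathbb M,s\models Q\bar x\,\varphi$ iff $\{\bar a\in M^q : \mathbb M,s[\bar a/\bar x]\models\varphi\}\in Q_M$, and the other clauses are the usual ones. A team $X$ of $M$ with domain a finite set $V$ of variables is a set of assignments $s:V\to M$. The formulas of $\mathrm I(Q)$ are built from first-order atomic formulas, independence atoms $\bar y\perp_{\bar x}\bar z$ (for tuples of variables) and the negations of both by $\wedge$, $\vee$, $\exists y$, $\forall y$ and $Q\bar x$. Their team semantics is: a first-order atomic or negated atomic formula holds in $X$ iff every $s\in X$ satisfies it; $\mathbb M,X\models\bar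 y\perp_{\bar x}\bar z$ iff for all $s,s'\in X$ with $s(\bar x)=s'(\bar x)$ there is $s_0\in X$ with $s_0(\bar x)=s(\bar x)$, $s_0(\bar y)=s(\bar y)$ and $s_0(\bar z)=s'(\bar z)$; a negated independence atom holds iff $X=\emptyset$; $\mathbb M,X\models\varphi\wedge\psi$ iff both $\mathbb M,X\models\varphi$ and $\mathbb M,X\models\psi$; $\mathbb M,X\models\varphi\vee\psi$ iff $X=Y\cup Z$ for some $Y,Z$ with $\mathbb M,Y\models\varphi$ and $\mathbb M,Z\models\psi$; $\mathbb M,X\models\exists y\,\varphi$ iff there is $f:X\to M$ with $\mathbb M,\{s[f(s)/y] : s\in X\}\models\varphi$; $\mathbb M,X\models\forall y\,\varphi$ iff $\mathbb M,\{s[a/y] : s\in X,\ a\in M\}\models\varphi$; $\mathbb M,X\models Q\bar x\,\varphi$ iff there is $F:X\to Q_M$ with $\mathbb M,\{s[\bar a/\bar x] : s\in X,\ \bar a\in F(s)\}\models\varphi$. For a team $X$ with domain $\{z_1,\dots,z_k\}$ (distinct variables) let $\mathrm{rel}(X)=\{(s(z_1),\dots,s(z_k)) : s\in X\}$. Theorem.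 Let $\tau$ be a signature and $R$ a $k$-ary relation symbol with $R\notin\tau$. Then for every $\tau\cup\{R\}$-sentence $\psi$ of $\mathrm{ESO}(Q)$ there is a $\tau$-formula $\varphi$ of $\mathrm I(Q)$ with free variables $\bar z=z_1,\dots,z_k$ such that for all $\tau$-structures $\mathbb M$ with non-empty universe and all teams $X$ of $M$ with domain $\{z_1,\dots,z_k\}$, $$\mathbb M,X\models\varphi\iff(\mathbb M,\mathrm{rel}(X))\models\psi\vee\forall\bar y\,\neg R(\bar y).$$ -/

import Mathlib

open FirstOrder FirstOrder.Language

universe u v w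

/-! ### Generalized quantifiers -/

/-- A generalized quantifier of type `⟨q⟩`: a class of structures `(M, A)` with `A ⊆ M ^ q`, given by
its local versions `Q M = {A ⊆ M ^ q | (M, A) ∈ Q}`. -/
abbrev GenQuantifier (q : ℕ) : Type (w + 1) := ∀ M : Type w, Set (Set (Fin q → M))

/-- `Q` is monotone increasing. Universes of structures are non-empty. -/
def GenQuantifier.IsMonotone {q : ℕ} (Q : GenQuantifier.{w} q) : Prop :=
  ∀ (M : Type w) [Nonempty M] (A B : Set (Fin q → M)), A ⊆ B → A ∈ Q M → B ∈ Q M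

/-- `Q` is non-trivial: `(M, ∅) ∉ Q` and `(M, M ^ q) ∈ Q` for all universes `M`. -/
def GenQuantifier.IsNontrivial {q : ℕ} (Q : GenQuantifier.{w} q) : Prop :=
  ∀ (M : Type w) [Nonempty M], (∅ : Set (Fin q → M)) ∉ Q M ∧ (Set.univ : Set (Fin q → M)) ∈ Q M

/-! ### Adding one symbol to a signature -/

/-- A family with exactly one element, of arity `r`. -/
inductive OneSym (r : ℕ) : ℕ → Type
  | sym : OneSym r r

/-- The signature with a single relation symbol, of arity `r`. -/
def oneRel (r : ℕ) : FirstOrder.Language.{0, 0} := ⟨fun _ => Empty, OneSym r⟩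

/-- The signature with a single function symbol, of arity `r`. -/
def oneFun (r : ℕ) : FirstOrder.Language.{0, 0} := ⟨OneSym r, fun _ => Empty⟩

/-- `(M, P)` as a structure for `oneRel r`. -/
abbrev relStructure {M : Type w} {r : ℕ} (P : Set (Fin r → M)) : (oneRel r).Structure M where
  funMap := fun f _ => nomatch f
  RelMap := fun R x => match R, x with
    | OneSym.sym, x => x ∈ P

/-- `(M, g)` as a structure for `oneFun r`. -/
abbrev funStructure {M : Type w} {r : ℕ} (g : (Fin r → M) → M) : (oneFun r).Structure M where
  funMap := fun f x => match f, x with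
    | OneSym.sym, x => g x
  RelMap := fun R _ => nomatch R

/-- The signature `L ∪ {R}`, where `R` is a relation symbol of arity `r` that is not in `L`. -/
abbrev withRel (L : FirstOrder.Language.{u, v}) (r : ℕ) : FirstOrder.Language.{u, v} := L.sum (oneRel r)

/-- The signature `L ∪ {f}`, where `f` is a function symbol of arity `r` that is not in `L`. -/
abbrev withFun (L : FirstOrder.Language.{u, v}) (r : ℕ) : FirstOrder.Language.{u, v} := L.sum (oneFun r)

/-- The expansion `(𝕄, P)` of an `L`-structure `𝕄` by a relation `P`. -/
abbrev expandRel {L : FirstOrder.Language.{u, v}} {M : Type w} (str : L.Structure M) {r : ℕ}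
    (P : Set (Fin r → M)) : (withRel L r).Structure M :=
  letI := str
  letI := relStructure P
  L.sumStructure (oneRel r) M

/-- The expansion `(𝕄, g)` of an `L`-structure `𝕄` by a function `g`. -/
abbrev expandFun {L : FirstOrder.Language.{u, v}} {M : Type w} (str : L.Structure M) {r : ℕ}
    (g : (Fin r → M) → M) : (withFun L r).Structure M :=
  letI := str
  letI := funStructure g
  L.sumStructure (oneFun r) M

/-! ### Assignments

Formulas are well-scoped: a formula over a set `α` of variables may use the variables in `α`, and a
quantifier that binds an `n`-tuple of variables is applied to a formula over `α ⊕ Fin n`, where the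
elements of `Fin n` are new variables. (So a quantifier never rebinds a variable.) -/

/-- The assignment `s[a/x]`, where `x` is a tuple of `n` new variables. -/
abbrev extendBy {α : Type} {M : Type w} {n : ℕ} (s : α → M) (a : Fin n → M) : α ⊕ Fin n → M :=
  Sum.elim s a

/-- The assignment `s[a/x]`, where `x` is one new variable. -/
abbrev extendOne {α : Type} {M : Type w} (s : α → M) (a : M) : α ⊕ Fin 1 → M :=
  extendBy s (fun _ => a)

/-! ### The logic `ESO(Q)` -/

/-- The `L`-formulas of `ESO(Q)` over the set `α` of first-order variables, for a quantifier symbol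
`Q` of type `⟨q⟩`: built from atomic and negated atomic formulas by conjunction, disjunction,
first-order quantification, `Q` quantification, and existential second-order quantification over
relations and functions. A second-order variable is a new symbol of the signature. -/
inductive ESOFormula (q : ℕ) : FirstOrder.Language.{u, v} → Type → Type (max (u + 1) (v + 1) 1)
  | eq {L : FirstOrder.Language.{u, v}} {α : Type} (t₁ t₂ : L.Term α) : ESOFormula q L α
  | neq {L : FirstOrder.Language.{u, v}} {α : Type} (t₁ t₂ : L.Term α) : ESOFormula q L α
  | rel {L : FirstOrder.Language.{u, v}} {α : Type} {n : ℕ} (R : L.Relations n) (ts : Fin n → L.Term α) :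
      ESOFormula q L α
  | nrel {L : FirstOrder.Language.{u, v}} {α : Type} {n : ℕ} (R : L.Relations n) (ts : Fin n → L.Term α) :
      ESOFormula q L α
  | and {L : FirstOrder.Language.{u, v}} {α : Type} (φ₁ φ₂ : ESOFormula q L α) : ESOFormula q L α
  | or {L : FirstOrder.Language.{u, v}} {α : Type} (φ₁ φ₂ : ESOFormula q L α) : ESOFormula q L α
  | ex {L : FirstOrder.Language.{u, v}} {α : Type} (φ : ESOFormula q L (α ⊕ Fin 1)) : ESOFormula q L α
  | all {L : FirstOrder.Language.{u, v}} {α : Type} (φ : ESOFormula q L (α ⊕ Fin 1)) : ESOFormula q L α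
  | gq {L : FirstOrder.Language.{u, v}} {α : Type} (φ : ESOFormula q L (α ⊕ Fin q)) : ESOFormula q L α
  | exRel {L : FirstOrder.Language.{u, v}} {α : Type} (r : ℕ) (φ : ESOFormula q (withRel L r) α) :
      ESOFormula q L α
  | exFun {L : FirstOrder.Language.{u, v}} {α : Type} (r : ℕ) (φ : ESOFormula q (withFun L r) α) :
      ESOFormula q L α

/-- `𝕄, s ⊨ φ` for a formula `φ` of `ESO(Q)`, where `str` is the structure `𝕄` with universe `M`. -/
def ESOFormula.Realize {q : ℕ} (Q : GenQuantifier.{w} q) {M : Type w} :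
    {L : FirstOrder.Language.{u, v}} → {α : Type} → ESOFormula q L α → L.Structure M → (α → M) → Prop
  | _, _, .eq t₁ t₂, str, s => letI := str; t₁.realize s = t₂.realize s
  | _, _, .neq t₁ t₂, str, s => letI := str; t₁.realize s ≠ t₂.realize s
  | _, _, .rel R ts, str, s => letI := str; Structure.RelMap R (fun i => (ts i).realize s)
  | _, _, .nrel R ts, str, s => letI := str; ¬ Structure.RelMap R (fun i => (ts i).realize s)
  | _, _, .and φ₁ φ₂, str, s => φ₁.Realize Q str s ∧ φ₂.Realize Q str s
  | _, _, .or φ₁ φ₂, str, s => φ₁.Realize Q str s ∨ φ₂.Realize Q str s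
  | _, _, .ex φ, str, s => ∃ a : M, φ.Realize Q str (extendOne s a)
  | _, _, .all φ, str, s => ∀ a : M, φ.Realize Q str (extendOne s a)
  | _, _, .gq φ, str, s => {a : Fin q → M | φ.Realize Q str (extendBy s a)} ∈ Q M
  | _, _, .exRel r φ, str, s => ∃ P : Set (Fin r → M), φ.Realize Q (expandRel str P) s
  | _, _, .exFun r φ, str, s => ∃ g : (Fin r → M) → M, φ.Realize Q (expandFun str g) s

/-- Sentences of `ESO(Q)`. -/
abbrev ESOSentence (q : ℕ) (L : FirstOrder.Language.{u, v}) := ESOFormula q L Empty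

/-- `𝕄 ⊨ ψ` for a sentence `ψ` of `ESO(Q)`. -/
def ESOSentence.Models {q : ℕ} (Q : GenQuantifier.{w} q) {M : Type w} {L : FirstOrder.Language.{u, v}}
    (str : L.Structure M) (ψ : ESOSentence q L) : Prop :=
  ESOFormula.Realize Q ψ str (fun x => nomatch x)

/-! ### Independence logic with a generalized quantifier -/

/-- The `L`-formulas of `I(Q)`, in negation normal form, over the set `α` of variables, for a
quantifier symbol `Q` of type `⟨q⟩`. The formula `indep y x z` is the independence atom `y ⊥_x z`
for tuples `y`, `x`, `z` of variables, and `nindep y x z` is its negation. -/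
inductive IFormula (L : FirstOrder.Language.{u, v}) (q : ℕ) : Type → Type (max u v 1)
  | eq {α : Type} (t₁ t₂ : L.Term α) : IFormula L q α
  | neq {α : Type} (t₁ t₂ : L.Term α) : IFormula L q α
  | rel {α : Type} {n : ℕ} (R : L.Relations n) (ts : Fin n → L.Term α) : IFormula L q α
  | nrel {α : Type} {n : ℕ} (R : L.Relations n) (ts : Fin n → L.Term α) : IFormula L q α
  | indep {α : Type} {a b c : ℕ} (y : Fin a → α) (x : Fin b → α) (z : Fin c → α) : IFormula L q α
  | nindep {α : Type} {a b c : ℕ} (y : Fin a → α) (x : Fin b → α) (z : Fin c → α) : IFormula L q α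
  | and {α : Type} (φ₁ φ₂ : IFormula L q α) : IFormula L q α
  | or {α : Type} (φ₁ φ₂ : IFormula L q α) : IFormula L q α
  | ex {α : Type} (φ : IFormula L q (α ⊕ Fin 1)) : IFormula L q α
  | all {α : Type} (φ : IFormula L q (α ⊕ Fin 1)) : IFormula L q α
  | gq {α : Type} (φ : IFormula L q (α ⊕ Fin q)) : IFormula L q α

/-- The set of variables of a term. -/
def termVars {L : FirstOrder.Language.{u, v}} {α : Type} : L.Term α → Set α
  | .var x => {x}
  | .func _ ts => ⋃ i, termVars (ts i)

/-- The set of free variables of a formula of `I(Q)`; all variables of an independence atom are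
free. -/
def IFormula.FV {L : FirstOrder.Language.{u, v}} {q : ℕ} : {α : Type} → IFormula L q α → Set α
  | _, .eq t₁ t₂ => termVars t₁ ∪ termVars t₂
  | _, .neq t₁ t₂ => termVars t₁ ∪ termVars t₂
  | _, .rel _ ts => ⋃ i, termVars (ts i)
  | _, .nrel _ ts => ⋃ i, termVars (ts i)
  | _, .indep y x z => Set.range y ∪ Set.range x ∪ Set.range z
  | _, .nindep y x z => Set.range y ∪ Set.range x ∪ Set.range z
  | _, .and φ₁ φ₂ => φ₁.FV ∪ φ₂.FV
  | _, .or φ₁ φ₂ => φ₁.FV ∪ φ₂.FV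
  | _, .ex φ => {x | Sum.inl x ∈ φ.FV}
  | _, .all φ => {x | Sum.inl x ∈ φ.FV}
  | _, .gq φ => {x | Sum.inl x ∈ φ.FV}

/-- A team of `M` with domain `α`. -/
abbrev Team (α : Type) (M : Type w) : Type w := Set (α → M)

/-- The team semantics `𝕄, X ⊨ φ` of `I(Q)`. -/
def IFormula.Sat {L : FirstOrder.Language.{u, v}} {q : ℕ} (Q : GenQuantifier.{w} q) {M : Type w}
    [L.Structure M] : {α : Type} → IFormula L q α → Team α M → Prop
  | _, .eq t₁ t₂, X => ∀ s ∈ X, t₁.realize s = t₂.realize s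
  | _, .neq t₁ t₂, X => ∀ s ∈ X, t₁.realize s ≠ t₂.realize s
  | _, .rel R ts, X => ∀ s ∈ X, Structure.RelMap R (fun i => (ts i).realize s)
  | _, .nrel R ts, X => ∀ s ∈ X, ¬ Structure.RelMap R (fun i => (ts i).realize s)
  | _, .indep y x z, X => ∀ s ∈ X, ∀ s' ∈ X, s ∘ x = s' ∘ x →
      ∃ s₀ ∈ X, s₀ ∘ x = s ∘ x ∧ s₀ ∘ y = s ∘ y ∧ s₀ ∘ z = s' ∘ z
  | _, .nindep _ _ _, X => X = ∅
  | _, .and φ₁ φ₂, X => φ₁.Sat Q X ∧ φ₂.Sat Q X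
  | _, .or φ₁ φ₂, X => ∃ Y Z : Team _ M, X = Y ∪ Z ∧ φ₁.Sat Q Y ∧ φ₂.Sat Q Z
  | _, .ex φ, X => ∃ f : X → M, φ.Sat Q {t | ∃ s : X, t = extendOne s.1 (f s)}
  | _, .all φ, X => φ.Sat Q {t | ∃ s ∈ X, ∃ a : M, t = extendOne s a}
  | _, .gq φ, X => ∃ F : X → Set (Fin q → M), (∀ s, F s ∈ Q M) ∧
      φ.Sat Q {t | ∃ s : X, ∃ a ∈ F s, t = extendBy s.1 a}

/-- For a team `X` with domain `{z₁, …, z_k}`, the relation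
`rel(X) = {(s(z₁), …, s(z_k)) | s ∈ X}`. -/
def teamRel {α : Type} {M : Type w} {k : ℕ} (z : Fin k ≃ α) (X : Team α M) : Set (Fin k → M) :=
  {y | ∃ s ∈ X, y = fun i => s (z i)}

/-!
Functions and relations are coded in a team. A function is carried by a tuple of universally
quantified variables together with one more variable that takes the value of the function at that
tuple: a dependence atom makes the value a function of the arguments, and an inclusion atom reads
values off the team. A non-empty relation is the set of points where two such functions agree, so
second-order quantifiers become first-order ones.

A formula of `ESO(Q)` is then translated by induction so that it is checked separately for each
assignment of the team. This rests on two one-sided claims. If the coding variables only take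
values in the graphs, then satisfaction of the translation by the team implies the formula at every
assignment; this is stable under subteams and arbitrary choices of new values. Conversely, if the
graphs are also covered above each value of the free variables, then the formula at every
assignment yields satisfaction, because witnesses can be chosen as functions of the free variables
alone, and such choices keep the graphs covered. In the step for `Q`, the team may choose sets
smaller than those defined by the formula, and the latter are in `Q` by monotonicity.

Finally, `rel(X)` itself is coded by two quantified functions. That their agreement set is contained
in `rel(X)` is expressed by an inclusion atom, and the converse inclusion by a first-order formula.
-/

variable {L : FirstOrder.Language.{u, v}} {q : ℕ} {Q : GenQuantifier.{w} q} {M : Type w}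
  {Γ Γ' I J : Type}

namespace Team

variable {X : Team Γ M}

/-- The supplement team `X[F/x]`, where `x` is a tuple of new variables indexed by `I`. The choice
function `F` is defined on all assignments, but only its values on `X` matter. -/
def supplement (X : Team Γ M) (F : (Γ → M) → Set (I → M)) : Team (Γ ⊕ I) M :=
  {t | t ∘ Sum.inl ∈ X ∧ t ∘ Sum.inr ∈ F (t ∘ Sum.inl)}

theorem supplement_eq_setOf_exists (X : Team Γ M) (F : (Γ → M) → Set (I → M)) :
    X.supplement F = {t | ∃ s ∈ X, ∃ a ∈ F s, t = Sum.elim s a} :=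
  Set.ext fun t => ⟨fun ht => ⟨_, ht.1, _, ht.2, (Sum.elim_comp_inl_inr t).symm⟩, by
    rintro ⟨s, hs, a, ha, rfl⟩
    exact ⟨hs, ha⟩⟩

theorem supplement_univ (X : Team Γ M) :
    (X.supplement fun _ => (Set.univ : Set (I → M))) = (· ∘ Sum.inl) ⁻¹' X :=
  Set.ext fun _ => and_iff_left trivial

theorem forall_mem_supplement {F : (Γ → M) → Set (I → M)} {p : (Γ ⊕ I → M) → Prop} :
    (∀ t ∈ X.supplement F, p t) ↔ ∀ s ∈ X, ∀ a ∈ F s, p (Sum.elim s a) := by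
  rw [supplement_eq_setOf_exists]
  constructor
  · exact fun h s hs a ha => h _ ⟨s, hs, a, ha, rfl⟩
  · rintro h _ ⟨s, hs, a, ha, rfl⟩
    exact h s hs a ha

end Team

namespace IFormula

theorem sat_empty (φ : IFormula L q Γ) [L.Structure M] : φ.Sat Q (∅ : Team Γ M) := by
  induction φ with
  | eq | neq | rel | nrel | indep | nindep => simp [Sat]
  | and _ _ h₁ h₂ => exact ⟨h₁, h₂⟩
  | or _ _ h₁ h₂ => exact ⟨∅, ∅, by simp, h₁, h₂⟩
  | ex φ h => exact ⟨fun s => s.2.elim, by simpa using h⟩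
  | all φ h => simpa [Sat] using h
  | gq φ h => exact ⟨fun s => s.2.elim, fun s => s.2.elim, by simpa using h⟩

variable [L.Structure M] {X : Team Γ M}

theorem sat_all {φ : IFormula L q (Γ ⊕ Fin 1)} :
    φ.all.Sat Q X ↔ φ.Sat Q ((· ∘ Sum.inl) ⁻¹' X) := by
  have : {t | ∃ s ∈ X, ∃ a : M, t = extendOne s a} = (· ∘ Sum.inl) ⁻¹' X := by
    ext t
    exact ⟨by rintro ⟨s, hs, a, rfl⟩; exact hs, fun ht => ⟨_, ht, t (Sum.inr 0), by
      ext (_ | i) <;> simp [Subsingleton.elim _ (0 : Fin 1)]⟩⟩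
  rw [Sat, this]

theorem sat_ex [Nonempty M] {φ : IFormula L q (Γ ⊕ Fin 1)} :
    φ.ex.Sat Q X ↔ ∃ f : (Γ → M) → Fin 1 → M, φ.Sat Q (X.supplement fun s => {f s}) := by
  have extend := (Subtype.val_injective (p := (· ∈ X))).surjective_comp_right (γ := M)
  simp only [Sat, Team.supplement_eq_setOf_exists, extend.exists, Subtype.exists, exists_prop,
    Set.mem_singleton_iff, exists_eq_left, Function.comp_apply,
    ((Equiv.refl (Γ → M)).arrowCongr (Equiv.funUnique (Fin 1) M)).symm.surjective.exists]
  rfl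

theorem sat_gq {φ : IFormula L q (Γ ⊕ Fin q)} :
    φ.gq.Sat Q X ↔ ∃ F : (Γ → M) → Set (Fin q → M), (∀ s ∈ X, F s ∈ Q M) ∧
      φ.Sat Q (X.supplement F) := by
  have extend := (Subtype.val_injective (p := (· ∈ X))).surjective_comp_right
    (γ := Set (Fin q → M))
  simp only [Sat, Team.supplement_eq_setOf_exists, extend.exists, Subtype.exists, exists_prop,
    Subtype.forall, Function.comp_apply]

/-- Renaming of the variables of a formula along a bijection. Team semantics is not local here,
because existential quantifiers choose a single value, so more general renamings change the
meaning. -/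
def rename : {Γ Γ' : Type} → (Γ ≃ Γ') → IFormula L q Γ → IFormula L q Γ'
  | _, _, e, .eq t₁ t₂ => .eq (t₁.relabel e) (t₂.relabel e)
  | _, _, e, .neq t₁ t₂ => .neq (t₁.relabel e) (t₂.relabel e)
  | _, _, e, .rel R ts => .rel R fun i => (ts i).relabel e
  | _, _, e, .nrel R ts => .nrel R fun i => (ts i).relabel e
  | _, _, e, .indep y x z => .indep (e ∘ y) (e ∘ x) (e ∘ z)
  | _, _, e, .nindep y x z => .nindep (e ∘ y) (e ∘ x) (e ∘ z)
  | _, _, e, .and φ₁ φ₂ => .and (φ₁.rename e) (φ₂.rename e)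
  | _, _, e, .or φ₁ φ₂ => .or (φ₁.rename e) (φ₂.rename e)
  | _, _, e, .ex φ => .ex (φ.rename (e.sumCongr (Equiv.refl _)))
  | _, _, e, .all φ => .all (φ.rename (e.sumCongr (Equiv.refl _)))
  | _, _, e, .gq φ => .gq (φ.rename (e.sumCongr (Equiv.refl _)))

theorem sat_rename [Nonempty M] (e : Γ ≃ Γ') (φ : IFormula L q Γ) (X : Team Γ' M) :
    (φ.rename e).Sat Q X ↔ φ.Sat Q ((· ∘ e.symm) ⁻¹' X) := by
  have bij {Γ Γ' : Type} (e : Γ ≃ Γ') : Function.Bijective fun s : Γ → M => s ∘ e.symm :=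
    (e.arrowCongr (Equiv.refl M)).bijective
  induction φ generalizing Γ' with
  | eq | neq | rel | nrel | indep | nindep =>
    simp [Sat, rename, Set.eq_empty_iff_forall_notMem, (bij e).surjective.forall,
      (bij e).surjective.exists, ← Function.comp_assoc, Function.comp_assoc _ e.symm e]
  | and _ _ h₁ h₂ => simp only [Sat, rename, h₁, h₂]
  | or φ₁ φ₂ h₁ h₂ =>
    simp only [Sat, rename, h₁, h₂, (Set.preimage_surjective.2 (bij e).1).exists,
      ← Set.preimage_union, (Set.preimage_injective.2 (bij e).2).eq_iff]
  | ex φ h =>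
    have surj := ((e.arrowCongr (Equiv.refl M)).arrowCongr (Equiv.refl (Fin 1 → M))).symm.surjective
    simp only [rename, sat_ex, h, surj.exists]
    rfl
  | all φ h => simp only [rename, sat_all, h]; rfl
  | gq φ h =>
    have surj := ((e.arrowCongr (Equiv.refl M)).arrowCongr
      (Equiv.refl (Set (Fin q → M)))).symm.surjective
    simp only [rename, sat_gq, h, surj.exists, (bij e).surjective.forall]
    rfl

end IFormula

/-- The property `P` of teams is defined by a formula of `I(Q)`, in all non-empty structures. -/
def TeamDefinable (Q : GenQuantifier.{w} q) (P : ∀ M : Type w, L.Structure M → Team Γ M → Prop) :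
    Prop :=
  ∃ φ : IFormula L q Γ, ∀ (M : Type w) [Nonempty M] [str : L.Structure M] (X : Team Γ M),
    φ.Sat Q X ↔ P M str X

/-- The property `P` of assignments is defined, assignment by assignment, by a formula of `I(Q)`. -/
abbrev FlatDefinable (Q : GenQuantifier.{w} q)
    (P : ∀ M : Type w, L.Structure M → (Γ → M) → Prop) : Prop :=
  TeamDefinable Q fun M str X => ∀ s ∈ X, P M str s

namespace TeamDefinable

theorem sat (Q : GenQuantifier.{w} q) (φ : IFormula L q Γ) :
    TeamDefinable Q fun M (_ : L.Structure M) X => φ.Sat Q X :=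
  ⟨φ, fun _ _ _ _ => Iff.rfl⟩

variable {P P' : ∀ M : Type w, L.Structure M → Team Γ M → Prop}

theorem congr (h : TeamDefinable Q P)
    (hP : ∀ (M : Type w) [Nonempty M] (str : L.Structure M) X, P M str X ↔ P' M str X) :
    TeamDefinable Q P' :=
  h.imp fun _ hφ M _ str X => (hφ M X).trans (hP M str X)

theorem rename (e : Γ ≃ Γ') (h : TeamDefinable Q P) :
    TeamDefinable Q fun M str X => P M str ((· ∘ e.symm) ⁻¹' X) :=
  let ⟨φ, hφ⟩ := h
  ⟨φ.rename e, fun M _ _ X => (φ.sat_rename e X).trans (hφ M _)⟩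

theorem and (h : TeamDefinable Q P) (h' : TeamDefinable Q P') :
    TeamDefinable Q fun M str X => P M str X ∧ P' M str X :=
  let ⟨φ, hφ⟩ := h
  let ⟨φ', hφ'⟩ := h'
  ⟨φ.and φ', fun M _ _ X => and_congr (hφ M X) (hφ' M X)⟩

theorem all [Finite I] {P : ∀ M : Type w, L.Structure M → Team (Γ ⊕ I) M → Prop}
    (h : TeamDefinable Q P) : TeamDefinable Q fun M str X => P M str ((· ∘ Sum.inl) ⁻¹' X) := by
  induction I using Finite.induction_empty_option generalizing Γ with
  | of_equiv e ih => exact ih (h.rename ((Equiv.refl Γ).sumCongr e.symm))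
  | h_empty => exact h.rename (Equiv.sumEmpty Γ PEmpty)
  | h_option ih =>
    obtain ⟨φ, hφ⟩ := h.rename <| ((Equiv.refl Γ).sumCongr <| (Equiv.optionEquivSumPUnit _).trans <|
      (Equiv.refl _).sumCongr finOneEquiv.symm).trans (Equiv.sumAssoc Γ _ (Fin 1)).symm
    exact ih ⟨φ.all, fun M _ _ X => IFormula.sat_all.trans (hφ M _)⟩

theorem ex {P : ∀ M : Type w, L.Structure M → Team (Γ ⊕ Fin 1) M → Prop}
    (h : TeamDefinable Q P) :
    TeamDefinable Q fun M str X =>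
      ∃ f : (Γ → M) → Fin 1 → M, P M str (X.supplement fun s => {f s}) :=
  let ⟨φ, hφ⟩ := h
  ⟨φ.ex, fun M _ _ _ => IFormula.sat_ex.trans (exists_congr fun _ => hφ M _)⟩

theorem indep [Finite Γ'] [Finite I] [Finite J] (y : Γ' → Γ) (x : I → Γ) (z : J → Γ) :
    TeamDefinable (L := L) Q fun M _ X => ∀ s ∈ X, ∀ s' ∈ X, s ∘ x = s' ∘ x →
      ∃ s₀ ∈ X, s₀ ∘ x = s ∘ x ∧ s₀ ∘ y = s ∘ y ∧ s₀ ∘ z = s' ∘ z := by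
  obtain ⟨_, ⟨d⟩⟩ := Finite.exists_equiv_fin Γ'
  obtain ⟨_, ⟨e⟩⟩ := Finite.exists_equiv_fin I
  obtain ⟨_, ⟨f⟩⟩ := Finite.exists_equiv_fin J
  refine ⟨.indep (y ∘ d.symm) (x ∘ e.symm) (z ∘ f.symm), fun M _ _ X => ?_⟩
  simp only [IFormula.Sat, ← Function.comp_assoc, d.symm.surjective.injective_comp_right.eq_iff,
    e.symm.surjective.injective_comp_right.eq_iff, f.symm.surjective.injective_comp_right.eq_iff]

theorem dependence [Finite I] (x : I → Γ) (y : Γ) :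
    TeamDefinable (L := L) Q fun M _ X => ∀ s ∈ X, ∀ s' ∈ X, s ∘ x = s' ∘ x → s y = s' y :=
  (indep (fun _ : Unit => y) x fun _ : Unit => y).congr fun M _ _ X => by
    refine forall₂_congr fun s hs => forall₂_congr fun s' _ => imp_congr_right fun _ => ⟨?_, ?_⟩
    · rintro ⟨s₀, -, -, h, h'⟩
      exact (congrFun h ()).symm.trans (congrFun h' ())
    · exact fun h => ⟨s, hs, rfl, rfl, funext fun _ => h⟩

theorem splitting {P' : ∀ M : Type w, L.Structure M → (Γ → M) → Prop} (h : TeamDefinable Q P)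
    (h' : FlatDefinable Q P') :
    TeamDefinable Q fun M str X => ∃ Y ⊆ X, P M str Y ∧ ∀ s ∈ X, s ∉ Y → P' M str s := by
  obtain ⟨φ, hφ⟩ := h
  obtain ⟨φ', hφ'⟩ := h'
  refine ⟨φ.or φ', fun M _ str X => ?_⟩
  simp only [IFormula.Sat, hφ, hφ']
  constructor
  · rintro ⟨Y, Z, rfl, hY, hZ⟩
    exact ⟨Y, Set.subset_union_left, hY, fun s hs hn => hZ s (hs.resolve_left hn)⟩
  · rintro ⟨Y, hYX, hY, hP⟩
    exact ⟨Y, X \ Y, (Set.union_sdiff_cancel hYX).symm, hY, fun s hs => hP s hs.1 hs.2⟩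

end TeamDefinable

namespace FlatDefinable

theorem eq (x y : Γ) : FlatDefinable (L := L) Q fun _ _ s => s x = s y :=
  ⟨.eq (.var x) (.var y), fun _ _ _ _ => Iff.rfl⟩

theorem ne (x y : Γ) : FlatDefinable (L := L) Q fun _ _ s => s x ≠ s y :=
  ⟨.neq (.var x) (.var y), fun _ _ _ _ => Iff.rfl⟩

theorem funMap_eq {n : ℕ} (f : L.Functions n) (x : Fin n → Γ) (y : Γ) :
    FlatDefinable Q fun _ str s => str.funMap f (s ∘ x) = s y :=
  ⟨.eq (.func f fun i => .var (x i)) (.var y), fun _ _ _ _ => Iff.rfl⟩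

theorem relMap {n : ℕ} (R : L.Relations n) (x : Fin n → Γ) :
    FlatDefinable Q fun _ str s => str.RelMap R (s ∘ x) :=
  ⟨.rel R fun i => .var (x i), fun _ _ _ _ => Iff.rfl⟩

theorem not_relMap {n : ℕ} (R : L.Relations n) (x : Fin n → Γ) :
    FlatDefinable Q fun _ str s => ¬ str.RelMap R (s ∘ x) :=
  ⟨.nrel R fun i => .var (x i), fun _ _ _ _ => Iff.rfl⟩

theorem true : FlatDefinable (L := L) (Γ := Γ) Q fun _ _ _ => True :=
  ⟨.indep Fin.elim0 Fin.elim0 Fin.elim0, fun _ _ _ _ => by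
    simp only [implies_true, iff_true]
    exact fun s hs s' _ _ => ⟨s, hs, rfl, rfl, Subsingleton.elim _ _⟩⟩

theorem false : FlatDefinable (L := L) (Γ := Γ) Q fun _ _ _ => False :=
  ⟨.nindep Fin.elim0 Fin.elim0 Fin.elim0, fun _ _ _ _ => Set.eq_empty_iff_forall_notMem⟩

variable {P P' : ∀ M : Type w, L.Structure M → (Γ → M) → Prop}

theorem and (h : FlatDefinable Q P) (h' : FlatDefinable Q P') :
    FlatDefinable Q fun M str s => P M str s ∧ P' M str s :=
  (TeamDefinable.and h h').congr fun _ _ _ _ => forall₂_and.symm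

theorem or (h : FlatDefinable Q P) (h' : FlatDefinable Q P') :
    FlatDefinable Q fun M str s => P M str s ∨ P' M str s :=
  (TeamDefinable.splitting h h').congr fun M _ str X => by
    constructor
    · rintro ⟨Y, -, hY, hP'⟩ s hs
      exact (em (s ∈ Y)).imp (hY s) (hP' s hs)
    · exact fun h => ⟨{s ∈ X | P M str s}, Set.sep_subset _ _, fun _ hs => hs.2,
        fun s hs hn => (h s hs).resolve_left fun hP => hn ⟨hs, hP⟩⟩

theorem exists_finite [Finite I] {P : I → ∀ M : Type w, L.Structure M → (Γ → M) → Prop}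
    (h : ∀ i, FlatDefinable Q (P i)) : FlatDefinable Q fun M str s => ∃ i, P i M str s := by
  induction I using Finite.induction_empty_option with
  | of_equiv e ih => simpa only [e.surjective.exists] using ih fun i => h (e i)
  | h_empty => simpa only [IsEmpty.exists_iff] using FlatDefinable.false
  | h_option ih => simpa only [Option.exists] using (h none).or (ih fun i => h (some i))

theorem forall_finite [Finite I] {P : I → ∀ M : Type w, L.Structure M → (Γ → M) → Prop}
    (h : ∀ i, FlatDefinable Q (P i)) : FlatDefinable Q fun M str s => ∀ i, P i M str s := by
  induction I using Finite.induction_empty_option with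
  | of_equiv e ih => simpa only [e.surjective.forall] using ih fun i => h (e i)
  | h_empty => simpa only [IsEmpty.forall_iff] using FlatDefinable.true
  | h_option ih => simpa only [Option.forall] using (h none).and (ih fun i => h (some i))

theorem tuple_eq [Finite I] (x y : I → Γ) :
    FlatDefinable (L := L) Q fun _ _ s => s ∘ x = s ∘ y := by
  simpa only [funext_iff, Function.comp_apply] using forall_finite fun i => eq (x i) (y i)

theorem tuple_ne [Finite I] (x y : I → Γ) :
    FlatDefinable (L := L) Q fun _ _ s => s ∘ x ≠ s ∘ y := by
  simpa only [Function.ne_iff, Function.comp_apply] using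
    exists_finite fun i => ne (x i) (y i)

end FlatDefinable

section Inclusion

variable {X : Team Γ M} {Y : Team (Γ ⊕ (I ⊕ Fin 2)) M} {x z : I → Γ}

theorem Team.inclusion_of_splitting (hYX : Y ⊆ (· ∘ Sum.inl) ⁻¹' X)
    (hY : ∀ t ∈ Y, t ∘ Sum.inr ∘ Sum.inl = t ∘ Sum.inl ∘ z ∨
      t (Sum.inr (Sum.inr 0)) = t (Sum.inr (Sum.inr 1)))
    (indep : ∀ t ∈ Y, ∀ t' ∈ Y, ∃ t₀ ∈ Y, t₀ ∘ Sum.inr ∘ Sum.inl = t ∘ Sum.inr ∘ Sum.inl ∧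
      t₀ ∘ Sum.inr ∘ Sum.inr = t' ∘ Sum.inr ∘ Sum.inr)
    (hX : ∀ t ∈ (· ∘ Sum.inl) ⁻¹' X, t ∉ Y → t ∘ Sum.inr ∘ Sum.inl ≠ t ∘ Sum.inl ∘ z ∧
      (t ∘ Sum.inr ∘ Sum.inl ≠ t ∘ Sum.inl ∘ x ∨
        t (Sum.inr (Sum.inr 0)) ≠ t (Sum.inr (Sum.inr 1)))) :
    ∀ s ∈ X, ∃ s' ∈ X, s' ∘ z = s ∘ x := by
  intro s hs
  obtain _ | ⟨a, b, hab⟩ := subsingleton_or_nontrivial M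
  · exact ⟨s, hs, Subsingleton.elim _ _⟩
  have diagonal : Sum.elim s (Sum.elim (s ∘ x) fun _ => a) ∈ Y := by
    by_contra h
    exact (hX _ hs h).2.elim (fun h => h rfl) fun h => h rfl
  have off_diagonal : Sum.elim s (Sum.elim (s ∘ z) ![a, b]) ∈ Y := by
    by_contra h
    exact (hX _ hs h).1 rfl
  obtain ⟨t, ht, hw, hv⟩ := indep _ diagonal _ off_diagonal
  refine ⟨t ∘ Sum.inl, hYX ht, ((hY t ht).resolve_right fun h => hab ?_).symm.trans hw⟩
  exact (congrFun hv 0).symm.trans (h.trans (congrFun hv 1))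

theorem Team.exists_splitting_of_inclusion (h : ∀ s ∈ X, ∃ s' ∈ X, s' ∘ z = s ∘ x) :
    ∃ Y ⊆ (· ∘ Sum.inl) ⁻¹' X,
      ((∀ t ∈ Y, t ∘ Sum.inr ∘ Sum.inl = t ∘ Sum.inl ∘ z ∨
        t (Sum.inr (Sum.inr 0)) = t (Sum.inr (Sum.inr 1))) ∧
      ∀ t ∈ Y, ∀ t' ∈ Y, ∃ t₀ ∈ Y, t₀ ∘ Sum.inr ∘ Sum.inl = t ∘ Sum.inr ∘ Sum.inl ∧
        t₀ ∘ Sum.inr ∘ Sum.inr = t' ∘ Sum.inr ∘ (Sum.inr : Fin 2 → I ⊕ Fin 2)) ∧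
      ∀ t ∈ (· ∘ Sum.inl) ⁻¹' X, t ∉ Y → t ∘ Sum.inr ∘ Sum.inl ≠ t ∘ Sum.inl ∘ z ∧
        (t ∘ Sum.inr ∘ Sum.inl ≠ t ∘ Sum.inl ∘ x ∨
          t (Sum.inr (Sum.inr 0)) ≠ t (Sum.inr (Sum.inr 1))) := by
  refine ⟨{t | t ∘ Sum.inl ∈ X ∧ (t ∘ Sum.inr ∘ Sum.inl = t ∘ Sum.inl ∘ z ∨
    t ∘ Sum.inr ∘ Sum.inl = t ∘ Sum.inl ∘ x ∧ t (Sum.inr (Sum.inr 0)) = t (Sum.inr (Sum.inr 1)))},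
    fun t ht => ht.1, ⟨fun t ht => ht.2.imp_right And.right, ?_⟩, fun t ht hn => ?_⟩
  · rintro t ⟨ht, hw⟩ t' -
    obtain ⟨s, hs, hsz⟩ : ∃ s ∈ X, s ∘ z = t ∘ Sum.inr ∘ Sum.inl :=
      hw.elim (fun hw => ⟨_, ht, hw.symm⟩) fun hw => hw.1 ▸ h _ ht
    exact ⟨Sum.elim s (Sum.elim (t ∘ Sum.inr ∘ Sum.inl) (t' ∘ Sum.inr ∘ Sum.inr)),
      ⟨hs, Or.inl hsz.symm⟩, rfl, rfl⟩
  · exact (not_or.1 fun h => hn ⟨ht, h⟩).imp_right not_and_or.1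

/-- Galliani's definition of the inclusion atom `x ⊆ z`: universally quantified `w`, `v₀` and `v₁`
satisfy `(w ≠ z ∧ (w ≠ x ∨ v₀ ≠ v₁)) ∨ ((w = z ∨ v₀ = v₁) ∧ w ⊥ v₀v₁)`. -/
theorem TeamDefinable.inclusion [Finite I] (x z : I → Γ) :
    TeamDefinable (L := L) Q fun M _ X => ∀ s ∈ X, ∃ s' ∈ X, s' ∘ z = s ∘ x := by
  have value := FlatDefinable.tuple_eq (L := L) (Q := Q)
    (Sum.inr ∘ Sum.inl : I → Γ ⊕ (I ⊕ Fin 2)) (Sum.inl ∘ z)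
  have constant := FlatDefinable.eq (L := L) (Q := Q)
    (Sum.inr (Sum.inr 0) : Γ ⊕ (I ⊕ Fin 2)) (Sum.inr (Sum.inr 1))
  have indep := TeamDefinable.indep (L := L) (Q := Q) (Γ := Γ ⊕ (I ⊕ Fin 2)) (Sum.inr ∘ Sum.inl)
    Fin.elim0 (Sum.inr ∘ Sum.inr)
  have not_value := FlatDefinable.tuple_ne (L := L) (Q := Q)
    (Sum.inr ∘ Sum.inl : I → Γ ⊕ (I ⊕ Fin 2)) (Sum.inl ∘ z)
  have not_constant := (FlatDefinable.tuple_ne (L := L) (Q := Q)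
    (Sum.inr ∘ Sum.inl : I → Γ ⊕ (I ⊕ Fin 2)) (Sum.inl ∘ x)).or
    (FlatDefinable.ne (Sum.inr (Sum.inr 0)) (Sum.inr (Sum.inr 1)))
  refine ((TeamDefinable.and (value.or constant) indep).splitting
    (not_value.and not_constant)).all.congr fun M _ _ X => ⟨?_, fun h => ?_⟩
  · rintro ⟨Y, hYX, ⟨hY, indep⟩, hX⟩
    refine Team.inclusion_of_splitting hYX hY (fun t ht t' ht' => ?_) hX
    obtain ⟨t₀, ht₀, -, h⟩ := indep t ht t' ht' (Subsingleton.elim _ _)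
    exact ⟨t₀, ht₀, h⟩
  · obtain ⟨Y, hYX, ⟨hY, indep⟩, hX⟩ := Team.exists_splitting_of_inclusion h
    refine ⟨Y, hYX, ⟨hY, fun t ht t' ht' _ => ?_⟩, hX⟩
    obtain ⟨t₀, ht₀, h⟩ := indep t ht t' ht'
    exact ⟨t₀, ht₀, Subsingleton.elim _ _, h⟩

end Inclusion

/-- The team obtained from `X` by letting new variables run through the graph of `g`: the variables
`Sum.inr (Sum.inl i)` carry an arbitrary argument, and `Sum.inr (Sum.inr 0)` its value. -/
def Team.graph (X : Team Γ M) (g : (I → M) → M) : Team (Γ ⊕ (I ⊕ Fin 1)) M :=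
  {t | t ∘ Sum.inl ∈ X ∧ t (Sum.inr (Sum.inr 0)) = g (t ∘ Sum.inr ∘ Sum.inl)}

theorem TeamDefinable.exFun [Finite I]
    {P : ∀ M : Type w, L.Structure M → Team (Γ ⊕ (I ⊕ Fin 1)) M → Prop} (h : TeamDefinable Q P) :
    TeamDefinable Q fun M str (X : Team Γ M) => ∃ g : (I → M) → M, P M str (X.graph g) := by
  have functional := TeamDefinable.dependence (L := L) (Q := Q) (Sum.inr ∘ Sum.inl)
    (Sum.inr (Sum.inr 0) : Γ ⊕ (I ⊕ Fin 1))
  refine ((functional.and h).rename (Equiv.sumAssoc Γ I (Fin 1)).symm).ex.all.congr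
    fun M _ str X => ?_
  have graph_eq {f : (Γ ⊕ I → M) → Fin 1 → M} {g : (I → M) → M}
      (hfg : ∀ s, s ∘ Sum.inl ∈ X → f s 0 = g (s ∘ Sum.inr)) :
      (· ∘ Equiv.sumAssoc Γ I (Fin 1)) ⁻¹' (Team.supplement ((· ∘ Sum.inl) ⁻¹' X) fun s => {f s}) =
        X.graph g := by
    ext t
    refine and_congr_right fun ht => ?_
    have value := hfg (t ∘ Equiv.sumAssoc Γ I (Fin 1) ∘ Sum.inl) ht
    rw [Set.mem_singleton_iff, funext_iff, Fin.forall_fin_one]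
    exact Eq.congr_right value
  constructor
  · rintro ⟨f, hf, hP⟩
    obtain ⟨g, hg⟩ : ∃ g : (I → M) → M, ∀ s, s ∘ Sum.inl ∈ X → f s 0 = g (s ∘ Sum.inr) := by
      have extend {s : Γ ⊕ I → M} (hs : s ∘ Sum.inl ∈ X) :
          Sum.elim s (f s) ∘ (Equiv.sumAssoc Γ I (Fin 1)).symm ∈
            (· ∘ Equiv.sumAssoc Γ I (Fin 1)) ⁻¹'
              Team.supplement ((· ∘ Sum.inl) ⁻¹' X) fun s => {f s} := by
        rw [Set.mem_preimage, Function.comp_assoc, Equiv.symm_comp_self]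
        exact ⟨hs, rfl⟩
      have factors : Function.FactorsThrough (fun s : {s : Γ ⊕ I → M // s ∘ Sum.inl ∈ X} => f s 0)
          fun s => s.1 ∘ Sum.inr := fun s s' h => hf _ (extend s.2) _ (extend s'.2) h
      obtain ⟨g, hg⟩ := (Function.factorsThrough_iff _).1 factors
      exact ⟨g, fun s hs => congrFun hg ⟨s, hs⟩⟩
    exact ⟨g, graph_eq hg ▸ hP⟩
  · rintro ⟨g, hg⟩
    refine ⟨fun s _ => g (s ∘ Sum.inr), ?_⟩
    simp only [Equiv.symm_symm]
    rw [graph_eq fun _ _ => rfl]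
    refine ⟨?_, hg⟩
    rintro t ⟨-, ht⟩ t' ⟨-, ht'⟩ h
    rw [ht, ht', h]

/-- How an `n`-ary function, depending on an assignment of the variables `α`, is read off a team
over `Γ`. The function coded by `graph _ a x y` is `b ↦ g ((v, b) ∘ a)`, where `v` is the assignment
of `α` and the variables `x` and `y` carry an argument of `g` and its value. -/
inductive FunCode (L : FirstOrder.Language.{u, v}) (α Γ : Type) (n : ℕ) : Type (max u 1)
  | base (f : L.Functions n) : FunCode L α Γ n
  | graph {I : Type} (finite : Finite I) (a : I → α ⊕ Fin n) (x : I → Γ) (y : Γ) : FunCode L α Γ n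

/-- How an `n`-ary relation is read off a team. The empty relation has its own code because in a
structure with one element any two functions agree somewhere. -/
inductive RelCode (L : FirstOrder.Language.{u, v}) (α Γ : Type) (n : ℕ) : Type (max u v 1)
  | base (R : L.Relations n) : RelCode L α Γ n
  | empty : RelCode L α Γ n
  | agree (F₁ F₂ : FunCode L α Γ n) : RelCode L α Γ n

/-- Relations between a tuple of variables, a variable, and a function. They serve to interpret
codes: the variables are to carry the arguments and the value of the function. -/
abbrev GraphProp (Γ : Type) (M : Type w) : Type (max w 1) :=
  ∀ ⦃I : Type⦄, (I → Γ) → Γ → ((I → M) → M) → Prop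

namespace Team

/-- Every assignment of the team is in the graph of the function. -/
def InGraph (X : Team Γ M) : GraphProp Γ M := fun _ x y g => ∀ s ∈ X, s y = g (s ∘ x)

/-- Every point of the graph of the function is taken by some assignment of the team, even if the
values of the variables `ι` are prescribed. -/
def CoversGraph {α : Type} (ι : α → Γ) (X : Team Γ M) : GraphProp Γ M := fun _ x y g =>
  ∀ s ∈ X, ∀ b, ∃ s' ∈ X, s' ∘ ι = s ∘ ι ∧ s' ∘ x = b ∧ s' y = g b

variable {α α' : Type} {X : Team Γ M} {X' : Team Γ' M} {x : I → Γ} {y : Γ} {g : (I → M) → M}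

theorem InGraph.map {j : Γ → Γ'} (hj : ∀ t ∈ X', t ∘ j ∈ X) (h : X.InGraph x y g) :
    X'.InGraph (j ∘ x) (j y) g :=
  fun t ht => h _ (hj t ht)

theorem CoversGraph.map {ι : α → Γ} {ι' : α' → Γ'} {j : Γ → Γ'} (hj : ∀ t ∈ X', t ∘ j ∈ X)
    (lift : ∀ t ∈ X', ∀ s ∈ X, s ∘ ι = t ∘ j ∘ ι → ∃ t' ∈ X', t' ∘ j = s ∧ t' ∘ ι' = t ∘ ι')
    (h : X.CoversGraph ι x y g) : X'.CoversGraph ι' (j ∘ x) (j y) g := by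
  intro t ht b
  obtain ⟨s, hs, hι, hx, hy⟩ := h _ (hj t ht) b
  obtain ⟨t', ht', rfl, hι'⟩ := lift t ht s hs hι
  exact ⟨t', ht', hι', hx, hy⟩

end Team

section Codes

variable {α α' : Type} {n : ℕ}

/-- Renaming of the variables of a code. -/
def FunCode.map (a : α → α') (j : Γ → Γ') : FunCode L α Γ n → FunCode L α' Γ' n
  | .base f => .base f
  | .graph hI o x y => .graph hI (Sum.map a id ∘ o) (j ∘ x) (j y)

/-- Renaming of the variables of a code. -/
def RelCode.map (a : α → α') (j : Γ → Γ') : RelCode L α Γ n → RelCode L α' Γ' n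
  | .base R => .base R
  | .empty => .empty
  | .agree F₁ F₂ => .agree (F₁.map a j) (F₂.map a j)

theorem FunCode.map_id (F : FunCode L α Γ n) : F.map id id = F := by
  cases F <;> simp [FunCode.map]

theorem RelCode.map_id (R : RelCode L α Γ n) : R.map id id = R := by
  cases R <;> simp [RelCode.map, FunCode.map_id]

variable [L.Structure M] {D : GraphProp Γ M} {D' : GraphProp Γ' M} {a : α → α'} {j : Γ → Γ'}

/-- The functions `h v`, for assignments `v` of `α`, are those read off by the code, if `D` holds
between variables and the function that they carry. -/
def FunCode.Interp (D : GraphProp Γ M) (h : (α → M) → (Fin n → M) → M) : FunCode L α Γ n → Prop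
  | .base f => ∀ v b, h v b = Structure.funMap f b
  | .graph _ o x y => ∃ g, (∀ v b, h v b = g (Sum.elim v b ∘ o)) ∧ D x y g

/-- The relations `h v`, for assignments `v` of `α`, are those read off by the code. -/
def RelCode.Interp (D : GraphProp Γ M) (h : (α → M) → (Fin n → M) → Prop) : RelCode L α Γ n → Prop
  | .base R => ∀ v b, h v b ↔ Structure.RelMap R b
  | .empty => ∀ v b, ¬ h v b
  | .agree F₁ F₂ => ∃ h₁ h₂, F₁.Interp D h₁ ∧ F₂.Interp D h₂ ∧ ∀ v b, h v b ↔ h₁ v b = h₂ v b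

theorem FunCode.Interp.map (hD : ∀ ⦃I⦄ ⦃x : I → Γ⦄ ⦃y g⦄, D x y g → D' (j ∘ x) (j y) g)
    {F : FunCode L α Γ n} {h : (α → M) → (Fin n → M) → M} (hF : F.Interp D h) :
    (F.map a j).Interp D' fun v => h (v ∘ a) := by
  cases F with
  | base f => exact fun v => hF _
  | graph _ o x y =>
    obtain ⟨g, hg, hxy⟩ := hF
    refine ⟨g, fun v b => ?_, hD hxy⟩
    rw [← Function.comp_assoc, Sum.elim_comp_map]
    exact hg _ b

theorem RelCode.Interp.map (hD : ∀ ⦃I⦄ ⦃x : I → Γ⦄ ⦃y g⦄, D x y g → D' (j ∘ x) (j y) g)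
    {R : RelCode L α Γ n} {h : (α → M) → (Fin n → M) → Prop} (hR : R.Interp D h) :
    (R.map a j).Interp D' fun v => h (v ∘ a) := by
  cases R with
  | base R => exact fun v => hR _
  | empty => exact fun v => hR _
  | agree F₁ F₂ =>
    obtain ⟨h₁, h₂, hF₁, hF₂, h⟩ := hR
    exact ⟨_, _, hF₁.map hD, hF₂.map hD, fun v => h _⟩

end Codes

/-- Codes for all symbols of `L'` in teams over `Γ` of `L`-structures. -/
structure CodeEnv (L L' : FirstOrder.Language.{u, v}) (α Γ : Type) : Type (max u v 1) where
  /-- The codes of the function symbols. -/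
  fn : ∀ {n : ℕ}, L'.Functions n → FunCode L α Γ n
  /-- The codes of the relation symbols. -/
  rl : ∀ {n : ℕ}, L'.Relations n → RelCode L α Γ n

namespace CodeEnv

variable {L' : FirstOrder.Language.{u, v}} {α α' : Type} {r : ℕ}

/-- Renaming of the variables of the codes. -/
def map (E : CodeEnv L L' α Γ) (a : α → α') (j : Γ → Γ') : CodeEnv L L' α' Γ' where
  fn f := (E.fn f).map a j
  rl R := (E.rl R).map a j

/-- Addition of a code for a new function symbol. -/
def addFun (E : CodeEnv L L' α Γ) (F : FunCode L α Γ r) : CodeEnv L (withFun L' r) α Γ where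
  fn
    | .inl f => E.fn f
    | .inr OneSym.sym => F
  rl
    | .inl R => E.rl R
    | .inr e => nomatch e

/-- Addition of a code for a new relation symbol. -/
def addRel (E : CodeEnv L L' α Γ) (R : RelCode L α Γ r) : CodeEnv L (withRel L' r) α Γ where
  fn
    | .inl f => E.fn f
    | .inr e => nomatch e
  rl
    | .inl R => E.rl R
    | .inr OneSym.sym => R

/-- Removal of the code for the last function symbol. -/
def dropFun (E : CodeEnv L (withFun L' r) α Γ) : CodeEnv L L' α Γ where
  fn f := E.fn (.inl f)
  rl R := E.rl (.inl R)

variable [L.Structure M]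

/-- The structures `S v`, for assignments `v` of `α`, are those read off by the codes. -/
structure Interp (E : CodeEnv L L' α Γ) (D : GraphProp Γ M) (S : (α → M) → L'.Structure M) :
    Prop where
  fn : ∀ {n : ℕ} (f : L'.Functions n), (E.fn f).Interp D fun v => (S v).funMap f
  rl : ∀ {n : ℕ} (R : L'.Relations n), (E.rl R).Interp D fun v => (S v).RelMap R

variable {E : CodeEnv L L' α Γ} {D : GraphProp Γ M} {S : (α → M) → L'.Structure M}

theorem Interp.map {D' : GraphProp Γ' M} {a : α → α'} {j : Γ → Γ'}
    (hD : ∀ ⦃I⦄ ⦃x : I → Γ⦄ ⦃y g⦄, D x y g → D' (j ∘ x) (j y) g) (h : E.Interp D S) :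
    (E.map a j).Interp D' fun v => S (v ∘ a) where
  fn f := (h.fn f).map hD
  rl R := (h.rl R).map hD

theorem Interp.mono {D' : GraphProp Γ M} (hD : ∀ ⦃I⦄ ⦃x : I → Γ⦄ ⦃y g⦄, D x y g → D' x y g)
    (h : E.Interp D S) : E.Interp D' S := by
  have := h.map (a := id) (j := id) hD
  simp only [CodeEnv.map, FunCode.map_id, RelCode.map_id] at this
  exact this

theorem Interp.addFun {F : FunCode L α Γ r} {g : (α → M) → (Fin r → M) → M} (h : E.Interp D S)
    (hF : F.Interp D g) : (E.addFun F).Interp D fun v => expandFun (S v) (g v) where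
  fn
    | .inl f => h.fn f
    | .inr OneSym.sym => hF
  rl
    | .inl R => h.rl R
    | .inr e => nomatch e

theorem Interp.addRel {R : RelCode L α Γ r} {A : (α → M) → Set (Fin r → M)} (h : E.Interp D S)
    (hR : R.Interp D fun v b => b ∈ A v) :
    (E.addRel R).Interp D fun v => expandRel (S v) (A v) where
  fn
    | .inl f => h.fn f
    | .inr e => nomatch e
  rl
    | .inl R => h.rl R
    | .inr OneSym.sym => hR

end CodeEnv

/-- The reduct of an expansion by a function. -/
abbrev reductFun {L' : FirstOrder.Language.{u, v}} {r : ℕ} (S : (withFun L' r).Structure M) :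
    L'.Structure M where
  funMap f := S.funMap (.inl f)
  RelMap R := S.RelMap (.inl R)

theorem CodeEnv.Interp.dropFun {L' : FirstOrder.Language.{u, v}} {α : Type} {r : ℕ}
    [L.Structure M] {E : CodeEnv L (withFun L' r) α Γ} {D : GraphProp Γ M}
    {S : (α → M) → (withFun L' r).Structure M} (h : E.Interp D S) :
    E.dropFun.Interp D fun v => reductFun (S v) where
  fn f := h.fn (.inl f)
  rl R := h.rl (.inl R)

/-- In teams in which the symbols of `L'` are read off by the codes `E`, the formula `φ` of `I(Q)`
defines the property `P` assignment by assignment. For `φ` to imply `P` it is enough that the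
team is in the graphs of the coded functions; for the converse the graphs have to be covered. -/
structure IFormula.Defines {L' : FirstOrder.Language.{u, v}} {α : Type} (Q : GenQuantifier.{w} q)
    (φ : IFormula L q Γ) (E : CodeEnv L L' α Γ) (ι : α → Γ)
    (P : ∀ M : Type w, L'.Structure M → (α → M) → Prop) : Prop where
  sound : ∀ {M : Type w} [Nonempty M] [L.Structure M] {X : Team Γ M}
    {S : (α → M) → L'.Structure M}, E.Interp X.InGraph S → φ.Sat Q X →
      ∀ s ∈ X, P M (S (s ∘ ι)) (s ∘ ι)
  complete : ∀ {M : Type w} [Nonempty M] [L.Structure M] {X : Team Γ M}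
    {S : (α → M) → L'.Structure M}, E.Interp (X.CoversGraph ι) S →
      (∀ s ∈ X, P M (S (s ∘ ι)) (s ∘ ι)) → φ.Sat Q X

/-- The property `P` is defined by `L`-formulas of `I(Q)`, whatever the codes of the symbols of `L'`
and for any choice `e` of the variables that `P` speaks about. -/
def Definable (L : FirstOrder.Language.{u, v}) {L' : FirstOrder.Language.{u, v}} {β : Type}
    (Q : GenQuantifier.{w} q) (P : ∀ M : Type w, L'.Structure M → (β → M) → Prop) : Prop :=
  ∀ ⦃α Γ : Type⦄ [Finite α] (E : CodeEnv L L' α Γ) (ι : α → Γ) (e : β → α),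
    ∃ φ : IFormula L q Γ, φ.Defines Q E ι fun M S s => P M S (s ∘ e)

variable {L' L₂ : FirstOrder.Language.{u, v}} {α β γ : Type}

namespace IFormula.Defines

variable {E : CodeEnv L L' α Γ} {ι : α → Γ}

theorem transfer {E₂ : CodeEnv L L₂ α Γ} {φ : IFormula L q Γ}
    {P : ∀ M : Type w, L'.Structure M → (α → M) → Prop}
    {P₂ : ∀ M : Type w, L₂.Structure M → (α → M) → Prop} (h : φ.Defines Q E₂ ι P₂)
    (hP : ∀ (M : Type w) [Nonempty M] [L.Structure M] (D : GraphProp Γ M)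
      (S : (α → M) → L'.Structure M), E.Interp D S →
        ∃ S₂, E₂.Interp D S₂ ∧ ∀ v, P₂ M (S₂ v) v ↔ P M (S v) v) :
    φ.Defines Q E ι P where
  sound hE hφ s hs :=
    let ⟨_, hE₂, hP⟩ := hP _ _ _ hE
    (hP _).1 (h.sound hE₂ hφ s hs)
  complete hE hs :=
    let ⟨_, hE₂, hP⟩ := hP _ _ _ hE
    h.complete hE₂ fun s hsX => (hP _).2 (hs s hsX)

variable {φ : IFormula L q (Γ ⊕ I)} {e : β → α}
  {P : ∀ M : Type w, L'.Structure M → (β ⊕ I → M) → Prop} [Nonempty M] [L.Structure M]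
  {X : Team Γ M} {S : (α → M) → L'.Structure M}

theorem of_sat_supplement (h : φ.Defines Q (E.map Sum.inl Sum.inl) (Sum.map ι id)
      fun M S s => P M S (s ∘ Sum.map e id)) (hE : E.Interp X.InGraph S)
    {F : (Γ → M) → Set (I → M)} (hφ : φ.Sat Q (X.supplement F)) :
    ∀ s ∈ X, ∀ a ∈ F s, P M (S (s ∘ ι)) (Sum.elim ((s ∘ ι) ∘ e) a) := by
  have := h.sound (hE.map fun _ _ _ _ => Team.InGraph.map fun _ ht => ht.1) hφ
  simpa only [Team.forall_mem_supplement, Sum.elim_comp_map, Sum.elim_comp_inl,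
    Function.comp_id] using this

-- The new values may depend on the variables `ι` only: otherwise the graphs need not stay covered.
theorem sat_supplement (h : φ.Defines Q (E.map Sum.inl Sum.inl) (Sum.map ι id)
      fun M S s => P M S (s ∘ Sum.map e id)) (hE : E.Interp (X.CoversGraph ι) S)
    {K : (α → M) → Set (I → M)}
    (hP : ∀ s ∈ X, ∀ a ∈ K (s ∘ ι), P M (S (s ∘ ι)) (Sum.elim ((s ∘ ι) ∘ e) a)) :
    φ.Sat Q (X.supplement fun s => K (s ∘ ι)) := by
  refine h.complete (S := fun v => S (v ∘ Sum.inl))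
    (hE.map fun _ _ _ _ => Team.CoversGraph.map (fun _ ht => ht.1) ?_) ?_
  · rintro t ⟨-, ht⟩ s hs hι
    refine ⟨Sum.elim s (t ∘ Sum.inr), ⟨hs, show _ ∈ K (s ∘ ι) from hι ▸ ht⟩, rfl, ?_⟩
    rw [Sum.elim_comp_map, hι]
    exact (Sum.elim_comp_inl_inr (t ∘ Sum.map ι id))
  · simpa only [Team.forall_mem_supplement, Sum.elim_comp_map, Sum.elim_comp_inl,
      Function.comp_id] using hP

end IFormula.Defines

namespace Definable

variable {P P' : ∀ M : Type w, L'.Structure M → (β → M) → Prop}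

theorem congr (h : Definable L Q P)
    (hP : ∀ (M : Type w) [Nonempty M] S s, P M S s ↔ P' M S s) : Definable L Q P' :=
  fun _ _ _ E ι e => (h E ι e).imp fun _ hφ => hφ.transfer fun M _ _ _ S hE =>
    ⟨S, hE, fun _ => hP M _ _⟩

theorem comp (h : Definable L Q P) (e : β → γ) : Definable L Q fun M S s => P M S (s ∘ e) :=
  fun _ _ _ E ι d => h E ι (d ∘ e)

theorem eq (x y : β) : Definable L Q fun M (_ : L'.Structure M) s => s x = s y := fun _ _ _ _ ι e =>
  let ⟨φ, hφ⟩ := FlatDefinable.eq (ι (e x)) (ι (e y))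
  ⟨φ, fun _ => (hφ _ _).1, fun _ => (hφ _ _).2⟩

theorem ne (x y : β) : Definable L Q fun M (_ : L'.Structure M) s => s x ≠ s y := fun _ _ _ _ ι e =>
  let ⟨φ, hφ⟩ := FlatDefinable.ne (ι (e x)) (ι (e y))
  ⟨φ, fun _ => (hφ _ _).1, fun _ => (hφ _ _).2⟩

theorem true : Definable L Q fun M (_ : L'.Structure M) (_ : β → M) => True := fun _ _ _ _ _ _ =>
  let ⟨φ, hφ⟩ := FlatDefinable.true
  ⟨φ, fun _ => (hφ _ _).1, fun _ => (hφ _ _).2⟩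

theorem false : Definable L Q fun M (_ : L'.Structure M) (_ : β → M) => False := fun _ _ _ _ _ _ =>
  let ⟨φ, hφ⟩ := FlatDefinable.false
  ⟨φ, fun _ => (hφ _ _).1, fun _ => (hφ _ _).2⟩

theorem and (h : Definable L Q P) (h' : Definable L Q P') :
    Definable L Q fun M S s => P M S s ∧ P' M S s := fun _ _ _ E ι e =>
  let ⟨φ, hφ⟩ := h E ι e
  let ⟨φ', hφ'⟩ := h' E ι e
  ⟨φ.and φ', fun hE hs s hsX => ⟨hφ.sound hE hs.1 s hsX, hφ'.sound hE hs.2 s hsX⟩, fun hE hs =>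
    ⟨hφ.complete hE fun s hsX => (hs s hsX).1, hφ'.complete hE fun s hsX => (hs s hsX).2⟩⟩

theorem or (h : Definable L Q P) (h' : Definable L Q P') :
    Definable L Q fun M S s => P M S s ∨ P' M S s := by
  intro α Γ _ E ι e
  obtain ⟨φ, hφ⟩ := h E ι e
  obtain ⟨φ', hφ'⟩ := h' E ι e
  refine ⟨φ.or φ', ?_, fun {M} _ _ X S hE hs => ?_⟩
  · rintro M _ _ _ S hE ⟨Y, Z, rfl, hY, hZ⟩ s (hs | hs)
    · exact .inl (hφ.sound (hE.mono fun _ _ _ _ h s hs => h s (.inl hs)) hY s hs)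
    · exact .inr (hφ'.sound (hE.mono fun _ _ _ _ h s hs => h s (.inr hs)) hZ s hs)
  · have covers (K : (α → M) → Prop) : E.Interp (Team.CoversGraph ι {s ∈ X | K (s ∘ ι)}) S :=
      hE.mono fun _ _ _ _ => Team.CoversGraph.map (j := id) (fun _ ht => ht.1) fun t ht s hs hι =>
        ⟨s, ⟨hs, hι ▸ ht.2⟩, rfl, hι⟩
    refine ⟨_, _, ?_, hφ.complete (covers fun v => P M (S v) (v ∘ e)) fun s hs => hs.2,
      hφ'.complete (covers fun v => P' M (S v) (v ∘ e)) fun s hs => hs.2⟩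
    rw [← Set.sep_or, Set.sep_eq_self_iff_mem_true.2 hs]

theorem forall_finite [Finite I] {P : I → ∀ M : Type w, L'.Structure M → (β → M) → Prop}
    (h : ∀ i, Definable L Q (P i)) : Definable L Q fun M S s => ∀ i, P i M S s := by
  induction I using Finite.induction_empty_option with
  | of_equiv e ih => simpa only [e.surjective.forall] using ih fun i => h (e i)
  | h_empty => simpa only [IsEmpty.forall_iff] using Definable.true
  | h_option ih => simpa only [Option.forall] using (h none).and (ih fun i => h (some i))

theorem ex {P : ∀ M : Type w, L'.Structure M → (β ⊕ Fin 1 → M) → Prop} (h : Definable L Q P) :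
    Definable L Q fun M S s => ∃ a : Fin 1 → M, P M S (Sum.elim s a) := by
  intro α Γ _ E ι e
  obtain ⟨φ, hφ⟩ := h (E.map Sum.inl Sum.inl) (Sum.map ι id) (Sum.map e id)
  refine ⟨φ.ex, fun hE hs s hsX => ?_, fun {M} _ _ X S hE hs => ?_⟩
  · obtain ⟨f, hf⟩ := IFormula.sat_ex.1 hs
    exact ⟨f s, hφ.of_sat_supplement hE hf s hsX _ rfl⟩
  · obtain ⟨f, hf⟩ : ∃ f : (α → M) → Fin 1 → M, ∀ v, (∃ a, P M (S v) (Sum.elim (v ∘ e) a)) →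
        P M (S v) (Sum.elim (v ∘ e) (f v)) :=
      ⟨fun v => Classical.epsilon _, fun v => Classical.epsilon_spec⟩
    refine IFormula.sat_ex.2 ⟨fun s => f (s ∘ ι), hφ.sat_supplement (K := fun v => {f v}) hE ?_⟩
    rintro s hsX _ rfl
    exact hf _ (hs s hsX)

theorem all {P : ∀ M : Type w, L'.Structure M → (β ⊕ Fin 1 → M) → Prop} (h : Definable L Q P) :
    Definable L Q fun M S s => ∀ a : Fin 1 → M, P M S (Sum.elim s a) := by
  intro α Γ _ E ι e
  obtain ⟨φ, hφ⟩ := h (E.map Sum.inl Sum.inl) (Sum.map ι id) (Sum.map e id)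
  refine ⟨φ.all, fun hE hs s hsX a => ?_, fun hE hs => ?_⟩
  · rw [IFormula.sat_all, ← Team.supplement_univ] at hs
    exact hφ.of_sat_supplement hE hs s hsX a trivial
  · rw [IFormula.sat_all, ← Team.supplement_univ]
    exact hφ.sat_supplement (K := fun _ => Set.univ) hE fun s hsX a _ => hs s hsX a

theorem gq {P : ∀ M : Type w, L'.Structure M → (β ⊕ Fin q → M) → Prop} (hmono : Q.IsMonotone)
    (h : Definable L Q P) : Definable L Q fun M S s => {a | P M S (Sum.elim s a)} ∈ Q M := by
  intro α Γ _ E ι e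
  obtain ⟨φ, hφ⟩ := h (E.map Sum.inl Sum.inl) (Sum.map ι id) (Sum.map e id)
  refine ⟨φ.gq, fun hE hs s hsX => ?_, fun {M} _ _ X S hE hs => ?_⟩
  · obtain ⟨F, hF, hsat⟩ := IFormula.sat_gq.1 hs
    exact hmono _ _ _ (hφ.of_sat_supplement hE hsat s hsX) (hF s hsX)
  · exact IFormula.sat_gq.2 ⟨_, hs, hφ.sat_supplement
      (K := fun v => {a | P M (S v) (Sum.elim (v ∘ e) a)}) hE fun _ _ _ ha => ha⟩

theorem exists_tuple [Finite I] {P : ∀ M : Type w, L'.Structure M → (β ⊕ I → M) → Prop}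
    (h : Definable L Q P) : Definable L Q fun M S s => ∃ a : I → M, P M S (Sum.elim s a) := by
  induction I using Finite.induction_empty_option generalizing β with
  | of_equiv e ih =>
    refine (ih (h.comp (Sum.map id e.symm))).congr fun M _ S s => ?_
    simp only [Sum.elim_comp_map, Function.comp_id]
    exact ((e.arrowCongr (Equiv.refl M)).surjective.exists
      (p := fun a => P M S (Sum.elim s a))).symm
  | h_empty =>
    refine (h.comp (Sum.elim id PEmpty.elim)).congr fun M _ S s => ?_
    rw [Unique.exists_iff, Sum.comp_elim, Function.comp_id, Subsingleton.elim (_ ∘ _) default]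
  | h_option ih =>
    refine (ih (ex (h.comp (Sum.elim (Sum.inl ∘ Sum.inl)
      fun i => i.elim (Sum.inr 0) (Sum.inl ∘ Sum.inr))))).congr fun M _ S s => ⟨?_, ?_⟩
    · rintro ⟨a, c, ha⟩
      refine ⟨fun i => i.elim (c 0) a, ?_⟩
      convert ha using 1
      ext (_ | _ | _) <;> rfl
    · rintro ⟨a, ha⟩
      refine ⟨a ∘ some, fun _ => a none, ?_⟩
      convert ha using 1
      ext (_ | _ | _) <;> rfl

theorem substitute [Finite I] {K : ∀ M : Type w, L'.Structure M → (β ⊕ I → M) → Prop}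
    {u : I → ∀ M : Type w, L'.Structure M → (β → M) → M} (hK : Definable L Q K)
    (hu : ∀ i, Definable L Q fun M S (s : β ⊕ I → M) => u i M S (s ∘ Sum.inl) = s (Sum.inr i)) :
    Definable L Q fun M S s => K M S (Sum.elim s fun i => u i M S s) :=
  ((forall_finite hu).and hK).exists_tuple.congr fun M _ S s => by
    simp only [Sum.elim_comp_inl, Sum.elim_inr, ← funext_iff, exists_eq_left']

theorem funMap_eq {n : ℕ} (f : L'.Functions n) (x : Fin n → β) (y : β) :
    Definable L Q fun M (S : L'.Structure M) s => S.funMap f (s ∘ x) = s y := by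
  intro α Γ _ E ι e
  rcases hF : E.fn f with f' | ⟨hI, o, x', y'⟩
  · obtain ⟨φ, hφ⟩ := FlatDefinable.funMap_eq (Q := Q) f' (ι ∘ e ∘ x) (ι (e y))
    refine ⟨φ, fun hE hs s hsX => ?_, fun hE hs => (hφ _ _).2 fun s hsX => ?_⟩ <;>
      have hf := hE.fn f <;> rw [hF] at hf
    · exact (hf _ _).trans ((hφ _ _).1 hs s hsX)
    · exact (hf _ _).symm.trans (hs s hsX)
  · obtain ⟨φ, hφ⟩ := TeamDefinable.inclusion (L := L) (Q := Q)
      (Sum.elim (Sum.elim ι (ι ∘ e ∘ x) ∘ o) fun _ : Unit => ι (e y)) (Sum.elim x' fun _ => y')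
    simp only [Sum.comp_elim, Sum.elim_eq_iff, ← Function.comp_assoc] at hφ
    refine ⟨φ, fun hE hs s hsX => ?_, fun hE hs => (hφ _ _).2 fun s hsX => ?_⟩ <;>
      have hf := hE.fn f <;> rw [hF] at hf <;> obtain ⟨g, hg, hx'y'⟩ := hf
    · obtain ⟨s', hs', hx', hy'⟩ := (hφ _ _).1 hs s hsX
      exact (hg _ _).trans (hx' ▸ (hx'y' s' hs').symm.trans (congrFun hy' ()))
    · obtain ⟨s', hs', -, hx', hy'⟩ := hx'y' s hsX (Sum.elim (s ∘ ι) (s ∘ ι ∘ e ∘ x) ∘ o)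
      exact ⟨s', hs', hx', funext fun _ => hy'.trans ((hg _ _).symm.trans (hs s hsX))⟩

theorem realize_eq (t : L'.Term β) (e : β → γ) (y : γ) :
    Definable L Q fun M (_ : L'.Structure M) s => t.realize (s ∘ e) = s y := by
  induction t generalizing γ with
  | var x => exact eq (e x) y
  | func f ts ih =>
    exact (funMap_eq f Sum.inr (Sum.inl y)).substitute
      (u := fun i M (_ : L'.Structure M) s => (ts i).realize (s ∘ e))
      fun i => ih i (Sum.inl ∘ e) (Sum.inr i)

theorem realize_eq_realize (t₁ t₂ : L'.Term β) :
    Definable L Q fun M (_ : L'.Structure M) s => t₁.realize s = t₂.realize s :=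
  (eq (Sum.inr 0) (Sum.inr 1)).substitute
    (u := ![fun M (_ : L'.Structure M) s => t₁.realize s,
      fun M (_ : L'.Structure M) s => t₂.realize s])
    (Fin.forall_fin_two.2 ⟨realize_eq t₁ _ _, realize_eq t₂ _ _⟩)

theorem realize_ne_realize (t₁ t₂ : L'.Term β) :
    Definable L Q fun M (_ : L'.Structure M) s => t₁.realize s ≠ t₂.realize s :=
  (ne (Sum.inr 0) (Sum.inr 1)).substitute
    (u := ![fun M (_ : L'.Structure M) s => t₁.realize s,
      fun M (_ : L'.Structure M) s => t₂.realize s])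
    (Fin.forall_fin_two.2 ⟨realize_eq t₁ _ _, realize_eq t₂ _ _⟩)

section Relations

variable {n : ℕ}

theorem relMap_of_realize_eq {p : Prop → Prop}
    (base : ∀ {Γ : Type} (R : L.Relations n) (x : Fin n → Γ),
      FlatDefinable Q fun M (str : L.Structure M) s => p (str.RelMap R (s ∘ x)))
    (empty : Definable L Q fun M (_ : L'.Structure M) (_ : β → M) => p False)
    (agree : ∀ t₁ t₂ : (withFun (withFun L' n) n).Term β,
      Definable L Q fun M (_ : (withFun (withFun L' n) n).Structure M) s =>
        p (t₁.realize s = t₂.realize s))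
    (R : L'.Relations n) (x : Fin n → β) :
    Definable L Q fun M (S : L'.Structure M) s => p (S.RelMap R (s ∘ x)) := by
  intro α Γ _ E ι e
  rcases hR : E.rl R with R' | _ | ⟨F₁, F₂⟩
  · obtain ⟨φ, hφ⟩ := base R' (ι ∘ e ∘ x)
    refine ⟨φ, fun hE hs s hsX => ?_, fun hE hs => (hφ _ _).2 fun s hsX => ?_⟩ <;>
      have h := hE.rl R <;> rw [hR] at h
    · exact (congrArg p (h _ _).eq).mpr ((hφ _ _).1 hs s hsX)
    · exact (congrArg p (h _ _).eq).mp (hs s hsX)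
  · obtain ⟨φ, hφ⟩ := empty E ι e
    refine ⟨φ, hφ.transfer fun M _ _ D S hE => ⟨S, hE, fun v => ?_⟩⟩
    have h := hE.rl R
    rw [hR] at h
    exact iff_of_eq (congrArg p (eq_false (h v _)).symm)
  · obtain ⟨φ, hφ⟩ := agree (.func (.inl (.inr OneSym.sym)) fun i => .var (x i))
      (.func (.inr OneSym.sym) fun i => .var (x i)) ((E.addFun F₁).addFun F₂) ι e
    refine ⟨φ, hφ.transfer fun M _ _ D S hE => ?_⟩
    have h := hE.rl R
    rw [hR] at h
    obtain ⟨h₁, h₂, hF₁, hF₂, h⟩ := h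
    exact ⟨_, (hE.addFun hF₁).addFun hF₂, fun v => iff_of_eq (congrArg p (h v _).eq.symm)⟩

theorem relMap (R : L'.Relations n) (x : Fin n → β) :
    Definable L Q fun M (S : L'.Structure M) s => S.RelMap R (s ∘ x) :=
  relMap_of_realize_eq (p := id) FlatDefinable.relMap Definable.false realize_eq_realize R x

theorem not_relMap (R : L'.Relations n) (x : Fin n → β) :
    Definable L Q fun M (S : L'.Structure M) s => ¬ S.RelMap R (s ∘ x) :=
  relMap_of_realize_eq (p := Not) FlatDefinable.not_relMap
    (Definable.true.congr fun _ _ _ _ => not_false_iff.symm) realize_ne_realize R x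

theorem relMap_realize (R : L'.Relations n) (ts : Fin n → L'.Term β) :
    Definable L Q fun M (S : L'.Structure M) s => S.RelMap R fun i => (ts i).realize s :=
  (relMap R Sum.inr).substitute (u := fun i M (_ : L'.Structure M) s => (ts i).realize s)
    fun i => realize_eq (ts i) Sum.inl (Sum.inr i)

theorem not_relMap_realize (R : L'.Relations n) (ts : Fin n → L'.Term β) :
    Definable L Q fun M (S : L'.Structure M) s => ¬ S.RelMap R fun i => (ts i).realize s :=
  (not_relMap R Sum.inr).substitute (u := fun i M (_ : L'.Structure M) s => (ts i).realize s)
    fun i => realize_eq (ts i) Sum.inl (Sum.inr i)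

end Relations

theorem exFun {r : ℕ} {P : ∀ M : Type w, (withFun L' r).Structure M → (β → M) → Prop}
    (h : Definable L Q P) :
    Definable L Q fun M S s => ∃ g : (Fin r → M) → M, P M (expandFun S g) s := by
  intro α Γ _ E ι e
  let F : FunCode L α (Γ ⊕ ((α ⊕ Fin r) ⊕ Fin 1)) r :=
    .graph inferInstance id (Sum.inr ∘ Sum.inl) (Sum.inr (Sum.inr 0))
  obtain ⟨φ, hφ⟩ := h ((E.map id Sum.inl).addFun F) (Sum.inl ∘ ι) e
  obtain ⟨φ', hφ'⟩ := (TeamDefinable.sat Q φ).exFun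
  refine ⟨φ', fun {M} _ _ X S hE hs s hsX => ?_, fun {M} _ _ X S hE hs => (hφ' _ _).2 ?_⟩
  · obtain ⟨g, hg⟩ := (hφ' _ _).1 hs
    have interp := (hE.map (a := id) (D' := (X.graph g).InGraph) fun _ _ _ _ =>
      Team.InGraph.map fun _ ht => ht.1).addFun (F := F)
        ⟨g, fun _ _ => rfl, fun _ ht => ht.2⟩
    obtain ⟨a⟩ : Nonempty (α ⊕ Fin r → M) := inferInstance
    exact ⟨_, hφ.sound interp hg (Sum.elim s (Sum.elim a fun _ => g a)) ⟨hsX, rfl⟩⟩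
  · obtain ⟨g, hg⟩ : ∃ g : (α → M) → (Fin r → M) → M, ∀ v,
        (∃ g, P M (expandFun (S v) g) (v ∘ e)) → P M (expandFun (S v) (g v)) (v ∘ e) :=
      ⟨fun v => Classical.epsilon _, fun v => Classical.epsilon_spec⟩
    let g' (b : α ⊕ Fin r → M) : M := g (b ∘ Sum.inl) (b ∘ Sum.inr)
    have interp := (hE.map (a := id) (D' := (X.graph g').CoversGraph (Sum.inl ∘ ι))
      fun _ _ _ _ => Team.CoversGraph.map (fun _ ht => ht.1) fun t ht s hs hι =>
        ⟨Sum.elim s (t ∘ Sum.inr), ⟨hs, ht.2⟩, rfl, hι⟩).addFun (F := F)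
        ⟨g', fun _ _ => rfl, fun t ht b => ⟨Sum.elim (t ∘ Sum.inl) (Sum.elim b fun _ => g' b),
          ⟨ht.1, rfl⟩, rfl, rfl, rfl⟩⟩
    exact ⟨g', hφ.complete interp fun t ht => hg _ (hs _ ht.1)⟩

end Definable

theorem exists_setOf_eq_eq [Nonempty M] {A : Set (I → M)} (hA : A.Nonempty) :
    ∃ g₁ g₂ : (I → M) → M, {x | g₁ x = g₂ x} = A := by
  obtain ⟨a, ha⟩ := hA
  by_cases h : A = Set.univ
  · exact ⟨Classical.arbitrary _, Classical.arbitrary _, by simp [h]⟩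
  · obtain ⟨b, hb⟩ := (Set.ne_univ_iff_exists_notMem A).1 h
    obtain ⟨i, hi⟩ := Function.ne_iff.1 (show a ≠ b from fun h => hb (h ▸ ha))
    classical
    refine ⟨fun _ => a i, fun x => if x ∈ A then a i else b i, ?_⟩
    ext x
    by_cases hx : x ∈ A <;> simp [hx, hi]

namespace Definable

variable {r : ℕ} {P : ∀ M : Type w, (withRel L' r).Structure M → (β → M) → Prop}

theorem expandRel_empty (h : Definable L Q P) :
    Definable L Q fun M S s => P M (expandRel S ∅) s := fun _ _ _ E ι e =>
  (h (E.addRel .empty) ι e).imp fun _ hφ => hφ.transfer fun _ _ _ _ _ hE =>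
    ⟨_, hE.addRel (A := fun _ => ∅) fun _ _ => id, fun _ => Iff.rfl⟩

theorem expandRel_agree (h : Definable L Q P) :
    Definable L Q fun M (S : (withFun (withFun L' r) r).Structure M) s =>
      P M (expandRel (reductFun (reductFun S))
        {x | S.funMap (.inl (.inr OneSym.sym)) x = S.funMap (.inr OneSym.sym) x}) s :=
  fun _ _ _ E ι e =>
    (h (E.dropFun.dropFun.addRel
        (.agree (E.fn (.inl (.inr OneSym.sym))) (E.fn (.inr OneSym.sym)))) ι e).imp
      fun _ hφ => hφ.transfer fun _ _ _ _ S hE =>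
        ⟨_, hE.dropFun.dropFun.addRel (A := fun v => {x |
          (S v).funMap (.inl (.inr OneSym.sym)) x = (S v).funMap (.inr OneSym.sym) x})
          ⟨_, _, hE.fn _, hE.fn _, fun _ _ => Iff.rfl⟩, fun _ => Iff.rfl⟩

theorem exRel (h : Definable L Q P) :
    Definable L Q fun M S s => ∃ A : Set (Fin r → M), P M (expandRel S A) s := by
  refine (h.expandRel_empty.or h.expandRel_agree.exFun.exFun).congr fun M _ S s => ⟨?_, ?_⟩
  · rintro (h | ⟨g₁, g₂, h⟩)
    · exact ⟨_, h⟩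
    · exact ⟨_, h⟩
  · rintro ⟨A, h⟩
    obtain rfl | hA := A.eq_empty_or_nonempty
    · exact .inl h
    · obtain ⟨g₁, g₂, rfl⟩ := exists_setOf_eq_eq hA
      exact .inr ⟨g₁, g₂, h⟩

theorem realize (hmono : Q.IsMonotone) (ψ : ESOFormula q L' β) :
    Definable L Q fun _ S s => ψ.Realize Q S s := by
  induction ψ with
  | eq t₁ t₂ => exact realize_eq_realize t₁ t₂
  | neq t₁ t₂ => exact realize_ne_realize t₁ t₂
  | rel R ts => exact relMap_realize R ts
  | nrel R ts => exact not_relMap_realize R ts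
  | and _ _ h₁ h₂ => exact h₁.and h₂
  | or _ _ h₁ h₂ => exact h₁.or h₂
  | ex _ h => exact h.ex.congr fun M _ _ _ => (Equiv.funUnique (Fin 1) M).symm.surjective.exists
  | all _ h => exact h.all.congr fun M _ _ _ => (Equiv.funUnique (Fin 1) M).symm.surjective.forall
  | gq _ h => exact h.gq hmono
  | exRel r _ h => exact h.exRel
  | exFun r _ h => exact h.exFun

end Definable

namespace Team

variable {X : Team Γ M} {z x₁ x₂ : I → Γ} {y₁ y₂ : Γ} {g₁ g₂ : (I → M) → M}

theorem image_subset_setOf_eq_iff (h₁ : X.InGraph x₁ y₁ g₁) (h₂ : X.InGraph x₂ y₂ g₂)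
    (rich : ∀ s ∈ X, ∀ b, ∃ s' ∈ X, s' ∘ z = s ∘ z ∧ s' ∘ x₁ = b ∧ s' ∘ x₂ = b) :
    (· ∘ z) '' X ⊆ {b | g₁ b = g₂ b} ↔
      ∀ s ∈ X, s ∘ x₁ = s ∘ z → s ∘ x₂ = s ∘ z → s y₁ = s y₂ := by
  rw [Set.image_subset_iff]
  constructor
  · intro h s hs e₁ e₂
    rw [h₁ s hs, h₂ s hs, e₁, e₂]
    exact h hs
  · intro h s hs
    obtain ⟨s', hs', hz, e₁, e₂⟩ := rich s hs (s ∘ z)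
    have := h s' hs' (e₁.trans hz.symm) (e₂.trans hz.symm)
    rwa [h₁ s' hs', h₂ s' hs', e₁, e₂] at this

theorem setOf_eq_subset_image_iff (hX : X.Nonempty) (h₁ : X.InGraph x₁ y₁ g₁)
    (h₂ : X.InGraph x₂ y₂ g₂)
    (rich : ∀ s ∈ X, ∀ b, ∃ s' ∈ X, s' ∘ z = s ∘ z ∧ s' ∘ x₁ = b ∧ s' ∘ x₂ = b) :
    {b | g₁ b = g₂ b} ⊆ (· ∘ z) '' X ↔ ∃ Y ⊆ X, (∀ s ∈ Y, ∃ s' ∈ Y, s' ∘ z = s ∘ x₁) ∧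
      ∀ s ∈ X, s ∉ Y → s ∘ x₁ ≠ s ∘ x₂ ∨ s y₁ ≠ s y₂ := by
  constructor
  · intro h
    refine ⟨{s ∈ X | s ∘ x₁ ∈ (· ∘ z) '' X}, Set.sep_subset _ _, ?_, fun s hs hn => ?_⟩
    · rintro s ⟨-, t, ht, hts⟩
      obtain ⟨t', ht', hz, e₁, -⟩ := rich t ht (t ∘ z)
      exact ⟨t', ⟨ht', t, ht, e₁.symm⟩, hz.trans hts⟩
    · by_contra! hc
      refine hn ⟨hs, h ?_⟩
      rw [Set.mem_ofPred_eq, ← h₁ s hs, hc.2, h₂ s hs, hc.1]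
  · rintro ⟨Y, hYX, hY, hn⟩ b hb
    obtain ⟨s, hs⟩ := hX
    obtain ⟨t, ht, -, rfl, e₂⟩ := rich s hs b
    have htY : t ∈ Y := by
      by_contra h
      refine (hn t ht h).elim (fun h => h e₂.symm) fun h => h ?_
      rw [h₁ t ht, h₂ t ht, e₂]
      exact hb
    obtain ⟨t', ht', h⟩ := hY t htY
    exact ⟨t', hYX ht', h⟩

end Team

theorem IFormula.exists_sat_iff_setOf_eq_eq_image (L : FirstOrder.Language.{u, v})
    (Q : GenQuantifier.{w} q) [Finite I] (z x₁ x₂ : I → Γ) (y₁ y₂ : Γ) :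
    ∃ ρ : IFormula L q Γ, ∀ {M : Type w} [Nonempty M] [L.Structure M] {X : Team Γ M}
      {g₁ g₂ : (I → M) → M}, X.Nonempty → X.InGraph x₁ y₁ g₁ → X.InGraph x₂ y₂ g₂ →
        (∀ s ∈ X, ∀ b, ∃ s' ∈ X, s' ∘ z = s ∘ z ∧ s' ∘ x₁ = b ∧ s' ∘ x₂ = b) →
          (ρ.Sat Q X ↔ {b | g₁ b = g₂ b} = (· ∘ z) '' X) := by
  obtain ⟨ρ, hρ⟩ := TeamDefinable.and
    ((FlatDefinable.tuple_ne (L := L) (Q := Q) x₁ z).or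
      ((FlatDefinable.tuple_ne x₂ z).or (FlatDefinable.eq y₁ y₂)))
    ((TeamDefinable.inclusion x₁ z).splitting
      ((FlatDefinable.tuple_ne x₁ x₂).or (FlatDefinable.ne y₁ y₂)))
  refine ⟨ρ, fun hX h₁ h₂ rich => ?_⟩
  rw [hρ, Set.Subset.antisymm_iff, and_comm, Team.image_subset_setOf_eq_iff h₁ h₂ rich,
    Team.setOf_eq_subset_image_iff hX h₁ h₂ rich]
  simp only [ne_eq, ← imp_iff_not_or, and_comm]

theorem Team.exists_mem_graph_graph {X : Team Γ M} {s : Γ → M} (hs : s ∈ X) (g₁ : (I → M) → M)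
    (g₂ : (J → M) → M) (b₁ : I → M) (b₂ : J → M) :
    ∃ t ∈ (X.graph g₁).graph g₂, t ∘ Sum.inl ∘ Sum.inl = s ∧
      t ∘ Sum.inl ∘ Sum.inr ∘ Sum.inl = b₁ ∧ t ∘ Sum.inr ∘ Sum.inl = b₂ :=
  ⟨Sum.elim (Sum.elim s (Sum.elim b₁ fun _ => g₁ b₁)) (Sum.elim b₂ fun _ => g₂ b₂),
    ⟨⟨hs, rfl⟩, rfl⟩, rfl, rfl, rfl⟩

theorem Team.image_graph_graph [Nonempty M] (X : Team Γ M) (g₁ : (I → M) → M) (g₂ : (J → M) → M)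
    (z : Γ' → Γ) : (· ∘ Sum.inl ∘ Sum.inl ∘ z) '' (X.graph g₁).graph g₂ = (· ∘ z) '' X := by
  refine Set.Subset.antisymm ?_ ?_
  · rintro _ ⟨t, ht, rfl⟩
    exact ⟨_, ht.1.1, rfl⟩
  · rintro _ ⟨s, hs, rfl⟩
    obtain ⟨t, ht, rfl, -⟩ := Team.exists_mem_graph_graph hs g₁ g₂ (Classical.arbitrary _)
      (Classical.arbitrary _)
    exact ⟨t, ht, rfl⟩

theorem ESOSentence.models_iff_realize (Q : GenQuantifier.{w} q) (ψ : ESOSentence q L)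
    (S : L.Structure M) (s : Empty → M) : Models Q S ψ ↔ ESOFormula.Realize Q ψ S s :=
  iff_of_eq (congrArg (ESOFormula.Realize Q ψ S) (Subsingleton.elim _ _))

theorem IFormula.exists_sat_graph_graph_iff (hmono : Q.IsMonotone) {k : ℕ}
    (ψ : ESOSentence q (withRel L k)) (z : Fin k → Γ) :
    ∃ φ : IFormula L q ((Γ ⊕ (Fin k ⊕ Fin 1)) ⊕ (Fin k ⊕ Fin 1)),
      ∀ (M : Type w) [Nonempty M] [str : L.Structure M] {X : Team Γ M} (g₁ g₂ : (Fin k → M) → M),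
        X.Nonempty → (φ.Sat Q ((X.graph g₁).graph g₂) ↔ {b | g₁ b = g₂ b} = (· ∘ z) '' X ∧
          ESOSentence.Models Q (expandRel str ((· ∘ z) '' X)) ψ) := by
  let x₁ : Fin k → (Γ ⊕ (Fin k ⊕ Fin 1)) ⊕ (Fin k ⊕ Fin 1) := Sum.inl ∘ Sum.inr ∘ Sum.inl
  let x₂ : Fin k → (Γ ⊕ (Fin k ⊕ Fin 1)) ⊕ (Fin k ⊕ Fin 1) := Sum.inr ∘ Sum.inl
  let y₁ : (Γ ⊕ (Fin k ⊕ Fin 1)) ⊕ (Fin k ⊕ Fin 1) := Sum.inl (Sum.inr (Sum.inr 0))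
  let y₂ : (Γ ⊕ (Fin k ⊕ Fin 1)) ⊕ (Fin k ⊕ Fin 1) := Sum.inr (Sum.inr 0)
  let E : CodeEnv L (withRel L k) Empty _ := CodeEnv.addRel ⟨.base, .base⟩
    (.agree (.graph inferInstance Sum.inr x₁ y₁) (.graph inferInstance Sum.inr x₂ y₂))
  obtain ⟨ρ, hρ⟩ :=
    IFormula.exists_sat_iff_setOf_eq_eq_image L Q (Sum.inl ∘ Sum.inl ∘ z) x₁ x₂ y₁ y₂
  obtain ⟨χ, hχ⟩ := Definable.realize hmono ψ E Empty.elim id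
  refine ⟨ρ.and χ, fun M _ str X g₁ g₂ hX => ?_⟩
  have in₁ : ((X.graph g₁).graph g₂).InGraph x₁ y₁ g₁ := fun t ht => ht.1.2
  have in₂ : ((X.graph g₁).graph g₂).InGraph x₂ y₂ g₂ := fun t ht => ht.2
  have rich {t} (ht : t ∈ (X.graph g₁).graph g₂) b := Team.exists_mem_graph_graph ht.1.1 g₁ g₂ b b
  obtain ⟨t, ht, -⟩ := Team.exists_mem_graph_graph hX.some_mem g₁ g₂
    (Classical.arbitrary _) (Classical.arbitrary _)
  have interp {D : GraphProp _ M} (h₁ : D x₁ y₁ g₁) (h₂ : D x₂ y₂ g₂)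
      (h : {b | g₁ b = g₂ b} = (· ∘ z) '' X) :
      E.Interp D fun _ => expandRel str ((· ∘ z) '' X) :=
    CodeEnv.Interp.addRel (S := fun _ => str) (A := fun _ => (· ∘ z) '' X)
      ⟨fun _ _ _ => rfl, fun _ _ _ => Iff.rfl⟩
      ⟨fun _ => g₁, fun _ => g₂, ⟨g₁, fun _ _ => rfl, h₁⟩, ⟨g₂, fun _ _ => rfl, h₂⟩,
        fun _ b => (Set.ext_iff.1 h b).symm⟩
  rw [IFormula.Sat, hρ ⟨t, ht⟩ in₁ in₂ fun s hs b => ?_, Team.image_graph_graph]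
  · refine and_congr_right fun h => ⟨fun hs => ?_, fun hψ => ?_⟩
    · exact (ESOSentence.models_iff_realize Q ψ _ _).2 (hχ.sound (interp in₁ in₂ h) hs t ht)
    · refine hχ.complete (interp (fun t ht b => ?_) (fun t ht b => ?_) h) fun _ _ =>
        (ESOSentence.models_iff_realize Q ψ _ _).1 hψ
      · obtain ⟨t', ht', -, rfl, -⟩ := rich ht b
        exact ⟨t', ht', Subsingleton.elim _ _, rfl, in₁ t' ht'⟩
      · obtain ⟨t', ht', -, -, rfl⟩ := rich ht b
        exact ⟨t', ht', Subsingleton.elim _ _, rfl, in₂ t' ht'⟩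
  · obtain ⟨t', ht', h, hb⟩ := rich hs b
    exact ⟨t', ht', congrArg (· ∘ z) h, hb⟩

theorem IFormula.exists_sat_iff_models (hmono : Q.IsMonotone) {k : ℕ}
    (ψ : ESOSentence q (withRel L k)) (z : Fin k → Γ) :
    ∃ φ : IFormula L q Γ, ∀ (M : Type w) [Nonempty M] [str : L.Structure M] {X : Team Γ M},
      X.Nonempty → (φ.Sat Q X ↔ ESOSentence.Models Q (expandRel str ((· ∘ z) '' X)) ψ) := by
  obtain ⟨ξ, hξ⟩ := IFormula.exists_sat_graph_graph_iff hmono ψ z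
  obtain ⟨φ, hφ⟩ := (TeamDefinable.sat Q ξ).exFun.exFun
  refine ⟨φ, fun M _ str X hX => ?_⟩
  obtain ⟨g₁, g₂, h⟩ := exists_setOf_eq_eq (hX.image (· ∘ z))
  simp only [hφ, hξ M _ _ hX, exists_and_right]
  exact and_iff_right ⟨g₁, g₂, h⟩

theorem mainTheorem3_general {q : ℕ} (Q : GenQuantifier.{w} q) (hmono : Q.IsMonotone)
    (L : FirstOrder.Language.{u, v}) (k : ℕ)
    (ψ : ESOSentence q (withRel L k)) {α : Type} (z : Fin k ≃ α) :
    ∃ φ : IFormula L q α, φ.FV = Set.univ ∧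
      ∀ (M : Type w) [Nonempty M] [str : L.Structure M] (X : Team α M),
        φ.Sat Q X ↔
          (ESOSentence.Models Q (expandRel str (teamRel z X)) ψ ∨
            ∀ y : Fin k → M, y ∉ teamRel z X) := by
  obtain ⟨φ, hφ⟩ := IFormula.exists_sat_iff_models hmono ψ z
  -- The independence atom is true; it makes all variables occur.
  refine ⟨φ.and (.indep z z z), by simp [IFormula.FV], fun M _ str X => ?_⟩
  have indep : (IFormula.indep z z z : IFormula L q α).Sat Q X :=
    fun s hs _ _ h => ⟨s, hs, rfl, rfl, h⟩
  have teamRel_eq : teamRel z X = (· ∘ z) '' X :=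
    Set.ext fun _ => exists_congr fun _ => and_congr_right' eq_comm
  rw [IFormula.Sat, and_iff_left indep, teamRel_eq, ← Set.eq_empty_iff_forall_notMem,
    Set.image_eq_empty]
  obtain rfl | hX := X.eq_empty_or_nonempty
  · exact iff_of_true φ.sat_empty (.inr rfl)
  · rw [hφ M hX, or_iff_left hX.ne_empty]

theorem mainTheorem3 {q : ℕ} (Q : GenQuantifier.{w} q) (hmono : Q.IsMonotone)
    (hnontriv : Q.IsNontrivial) (L : FirstOrder.Language.{u, v}) (k : ℕ)
    (ψ : ESOSentence q (withRel L k)) {α : Type} (z : Fin k ≃ α) :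
    ∃ φ : IFormula L q α, φ.FV = Set.univ ∧
      ∀ (M : Type w) [Nonempty M] [str : L.Structure M] (X : Team α M),
        φ.Sat Q X ↔
          (ESOSentence.Models Q (expandRel str (teamRel z X)) ψ ∨
            ∀ y : Fin k → M, y ∉ teamRel z X) :=
  mainTheorem3_general Q hmono L k ψ z
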